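/- Let $D\ge 0$, $N\ge 0$ be integers, $t_0<t_f$, $\Omega=[t_0,t_f]$, $\mathbf F:\mathbb R^D\times\Omega\to\mathbb R^D$, $\mathbf u_0\in\mathbb R^D$, and let $|\cdot|$ be the maximum norm on $\mathbb R^D$. Let $\tau_0<\dots<\tau_N$ be the roots of the shifted Legendre polynomial of degree $N+1$ on $[0,1]$, $\varphi_0,\dots,\varphi_N$ the Lagrange basis polynomials of degree $N$ on these nodes, $w_p=\int_0^1\varphi_p\,d\tau$, $K_{pq}=\varphi_p(1)\varphi_q(1)-\int_0^1\varphi_p'\varphi_q\,d\tau$, $M_{pq}=\int_0^1\varphi_p\varphi_q\,d\tau$, and $A=K^{-1}M$. For a grid $t_0<t_1<\dots<t_M=t_f$ (not necessarily uniform) put $\Delta t_n=t_{n+1}-t_n$, $\Delta t=\max_n\Delta t_n$, $\Omega_n=[t_n,t_{n+1}]$ and $t(\tau)=t_n+\tau\Delta t_n$. The ADER-DG solution with local DG predictor of $\mathbf u'=\mathbf F(\mathbf u,t)$, $\mathbf u(t_0)=\mathbf u_0$, consists of nodal values $\mathbf u_n$ ($\mathbf u_0$ being the initial value) and coefficients $\hat{\mathbf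 q}_{n,p}$ with $$\hat{\mathbf q}_{n,p}-\Delta t_n\sum_{q=0}^N A_{pq}\mathbf F(\hat{\mathbf q}_{n,q},t(\tau_q))=\mathbf u_n,\qquad \mathbf u_{n+1}=\mathbf u_n+\Delta t_n\sum_{p=0}^N w_p\mathbf F(\hat{\mathbf q}_{n,p},t(\tau_p)).$$ The local solution is $\mathbf q_n(\tau)=\sum_p\hat{\mathbf q}_{n,p}\varphi_p(\tau)$, and the improved local solution is $$\mathbf q_n^{\rm IL}(\tau)=\mathbf u_n+\Delta t_n\int_0^\tau\sum_{p=0}^N\mathbf F(\hat{\mathbf q}_{n,p},t(\tau_p))\varphi_p(\xi)\,d\xi,$$ that is, $\mathbf u_n+\Delta t_n\int_0^\tau\mathbf F(\mathbf q_n(\xi),t(\xi))\,d\xi$ with the integrand replaced by its interpolant at the Gauss nodes. The functions $\mathbf u_L$ and $\mathbf u_{\rm IL}$ on $\Omega$ are assembled piecewise from $\mathbf q_n((t-t_n)/\Delta t_n)$ and $\mathbf q_n^{\rm IL}((t-t_n)/\Delta t_n)$ on the cells (the cell $[t_n,t_{n+1})$, closed on the right for the last one). (a) For every grid and every ADER-DG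 solution on it, $\mathbf q_n^{\rm IL}(\tau)=\mathbf u_n+\Delta t_n\sum_p\mathbf F(\mathbf q_n(\tau_p),t(\tau_p))\int_0^\tau\varphi_p(\xi)\,d\xi$, $\mathbf q_n^{\rm IL}(0)=\mathbf u_n$ and $\mathbf q_n^{\rm IL}(1)=\mathbf u_{n+1}$ for all $n$; hence $\mathbf u_{\rm IL}(t_n)=\mathbf u_n$ at all grid nodes and $\mathbf u_{\rm IL}$ is continuous on $\Omega$. (b) Let $N\ge1$, let $\mathbf F$ be of class $C^{N+2}$ on $\mathbb R^D\times\Omega$ and Lipschitz in its first argument, uniformly on $\Omega$: $|\mathbf F(\mathbf x,t)-\mathbf F(\mathbf y,t)|\le L_F|\mathbf x-\mathbf y|$ for all $\mathbf x,\mathbf y\in\mathbb R^D$, $t\in\Omega$. Let $\mathbf u$ be the exact solution of the initial value problem on $\Omega$. Then there are $C>0$ and $\delta>0$, independent of the grid, such that on every grid with $\Delta t\le\delta$ an ADER-DG solution exists, and every ADER-DG solution satisfies $$\sup_{t\in\Omega}|\mathbf u_{\rm IL}(t)-\mathbf u(t)|\le C\,\Delta t^{N+2},\qquad \|\mathbf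 u_{\rm IL}-\mathbf u\|_{L_\infty(\Omega)}\le C\,\Delta t^{N+2},\qquad \|\mathbf u_{\rm IL}-\mathbf u\|_{L_p(\Omega)}\le |\Omega|^{1/p}C\,\Delta t^{N+2}\quad(1\le p<\infty),$$ one order higher than the estimates for the local solution, which are $\|\mathbf u_L-\mathbf u\|_{L_\infty(\Omega)}\le C\,\Delta t^{N+1}$ and $\|\mathbf u_L-\mathbf u\|_{L_p(\Omega)}\le|\Omega|^{1/p}C\,\Delta t^{N+1}$ $(1\le p<\infty)$. -/

import Mathlib

open MeasureTheory Set Polynomial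

noncomputable section

namespace ADERDG

/-- The shifted Legendre polynomial on `[0, 1]` of degree `n`, with real coefficients. -/
def legendre (n : ℕ) : ℝ[X] :=
  (Polynomial.shiftedLegendre n).map (Int.castRingHom ℝ)

/-- The Gauss nodes `τ_0 < ⋯ < τ_N`: the real roots of the shifted Legendre polynomial of
degree `N + 1`, in ascending order. That polynomial has `N + 1` distinct real roots, so the
default value of `getD` is never used. -/
def node (N : ℕ) (k : Fin (N + 1)) : ℝ :=
  ((legendre (N + 1)).roots.toFinset.sort (· ≤ ·)).getD k 0

/-- The Lagrange basis polynomials `φ_p` on the Gauss nodes. -/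
def phi (N : ℕ) (p : Fin (N + 1)) : ℝ[X] :=
  Lagrange.basis Finset.univ (node N) p

/-- The Gauss-Legendre weights `w_p = ∫₀¹ φ_p`. -/
def weight (N : ℕ) (p : Fin (N + 1)) : ℝ :=
  ∫ τ in (0 : ℝ)..1, (phi N p).eval τ

/-- `K_pq = φ_p(1) φ_q(1) - ∫₀¹ φ_p' φ_q`. -/
def matK (N : ℕ) : Matrix (Fin (N + 1)) (Fin (N + 1)) ℝ :=
  Matrix.of fun p q => (phi N p).eval 1 * (phi N q).eval 1 -
    ∫ τ in (0 : ℝ)..1, (derivative (phi N p)).eval τ * (phi N q).eval τ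

/-- `M_pq = ∫₀¹ φ_p φ_q`. -/
def matM (N : ℕ) : Matrix (Fin (N + 1)) (Fin (N + 1)) ℝ :=
  Matrix.of fun p q => ∫ τ in (0 : ℝ)..1, (phi N p).eval τ * (phi N q).eval τ

/-- `A = K⁻¹ M`. -/
def matA (N : ℕ) : Matrix (Fin (N + 1)) (Fin (N + 1)) ℝ :=
  (matK N)⁻¹ * matM N

/-- A grid `t_0 < t_1 < ⋯ < t_M = t_f` with `M` cells, not necessarily uniform. -/
structure Grid (t₀ tf : ℝ) (M : ℕ) where
  pt : Fin (M + 1) → ℝ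
  strictMono : StrictMono pt
  first : pt 0 = t₀
  last : pt (Fin.last M) = tf

namespace Grid

variable {t₀ tf : ℝ} {M : ℕ}

/-- `Δt_n = t_{n+1} - t_n`. -/
def step (g : Grid t₀ tf M) (n : Fin M) : ℝ :=
  g.pt n.succ - g.pt n.castSucc

/-- `Δt = max_n Δt_n`. -/
def mesh (g : Grid t₀ tf M) : ℝ :=
  ⨆ n, g.step n

/-- `t(τ) = t_n + τ Δt_n`. -/
def time (g : Grid t₀ tf M) (n : Fin M) (τ : ℝ) : ℝ :=
  g.pt n.castSucc + τ * g.step n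

/-- The cells, made disjoint: `[t_n, t_{n+1})`, and the closed interval for the last one. -/
def cell (g : Grid t₀ tf M) (n : Fin M) : Set ℝ :=
  if (n : ℕ) + 1 = M then Icc (g.pt n.castSucc) (g.pt n.succ)
  else Ico (g.pt n.castSucc) (g.pt n.succ)

/-- The piecewise assembly `t ↦ ∑ₙ χₙ(t) vₙ((t - tₙ) / Δtₙ)`. -/
def assemble {D : ℕ} (g : Grid t₀ tf M) (v : Fin M → ℝ → Fin D → ℝ) (t : ℝ) : Fin D → ℝ :=
  ∑ n, (g.cell n).indicator (fun s => v n ((s - g.pt n.castSucc) / g.step n)) t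

end Grid

variable {D N M : ℕ} {t₀ tf : ℝ}

/-- `U` (nodal values `u_n`) and `Q` (predictor coefficients `q̂_{n,p}`) solve the ADER-DG method
with local DG predictor for `u' = F(u, t)`, `u(t₀) = u₀`, on the grid `g`. -/
structure IsSolution (F : (Fin D → ℝ) → ℝ → Fin D → ℝ) (u₀ : Fin D → ℝ) (g : Grid t₀ tf M)
    (U : Fin (M + 1) → Fin D → ℝ) (Q : Fin M → Fin (N + 1) → Fin D → ℝ) : Prop where
  init : U 0 = u₀
  predictor : ∀ n p,
    Q n p - g.step n • ∑ q, matA N p q • F (Q n q) (g.time n (node N q)) = U n.castSucc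
  update : ∀ n,
    U n.succ = U n.castSucc + g.step n • ∑ p, weight N p • F (Q n p) (g.time n (node N p))

/-- The local solution on a cell, `q_n(τ) = ∑_p q̂_{n,p} φ_p(τ)`. -/
def localSol (Q : Fin M → Fin (N + 1) → Fin D → ℝ) (n : Fin M) (τ : ℝ) : Fin D → ℝ :=
  ∑ p, (phi N p).eval τ • Q n p

/-- The point-wise evaluation of `F(q_n(τ), t(τ))`: its Lagrange interpolant on the Gauss nodes,
`∑_p F(q_n(τ_p), t(τ_p)) φ_p(τ)`. -/
def pointwiseF (F : (Fin D → ℝ) → ℝ → Fin D → ℝ) (g : Grid t₀ tf M)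
    (Q : Fin M → Fin (N + 1) → Fin D → ℝ) (n : Fin M) (τ : ℝ) : Fin D → ℝ :=
  ∑ p, (phi N p).eval τ • F (Q n p) (g.time n (node N p))

/-- The improved local solution on a cell,
`q_n^IL(τ) = u_n + Δt_n ∫₀^τ F(q_n(ξ), t(ξ)) dξ` with `F` evaluated point-wise. -/
def improvedLocalSol (F : (Fin D → ℝ) → ℝ → Fin D → ℝ) (g : Grid t₀ tf M)
    (U : Fin (M + 1) → Fin D → ℝ) (Q : Fin M → Fin (N + 1) → Fin D → ℝ)
    (n : Fin M) (τ : ℝ) : Fin D → ℝ :=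
  U n.castSucc + g.step n • ∫ ξ in (0 : ℝ)..τ, pointwiseF F g Q n ξ

/-- The local solution `u_L` on the whole interval. -/
def uL (g : Grid t₀ tf M) (Q : Fin M → Fin (N + 1) → Fin D → ℝ) : ℝ → Fin D → ℝ :=
  g.assemble (localSol Q)

/-- The improved local solution `u_IL` on the whole interval. -/
def uIL (F : (Fin D → ℝ) → ℝ → Fin D → ℝ) (g : Grid t₀ tf M)
    (U : Fin (M + 1) → Fin D → ℝ) (Q : Fin M → Fin (N + 1) → Fin D → ℝ) : ℝ → Fin D → ℝ :=
  g.assemble (improvedLocalSol F g U Q)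

end ADERDG

end

noncomputable section

namespace ADERDG

/-! ### Shifted Legendre polynomials, their roots, and Gauss quadrature. -/

section

/-! The nodal matching in (a) holds because `improvedLocalSol` at 1 has exactly the weights `weight
N p` in front of the values of `F`, so it reproduces the update; neighbouring pieces then agree at
the common node, and finitely many closed cells glue to a continuous function.

For (b), read the method as an implicit Runge-Kutta scheme with matrix `matA N` and the Gauss
weights. Integration by parts shows that the matrix is exact only for polynomials of degree less
than `N` (`sum_matA_mul`), so the exact solution satisfies the stage equations with a defect `h ^ (N
+ 1) * stageDefect N p` times a vector that does not depend on the stage, up to `O(h ^ (N + 2))`.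
Taken alone, this bound on the stages would give nodal order `N + 1`. The missing order comes from a
cancellation: the weight vector is orthogonal to `stageDefect` (`sum_weight_mul_stageDefect`), since
the weights times the matrix are the moments against `1 - τ` (`sum_weight_mul_sum_matA`) and Gauss
quadrature integrates `τ ^ (N + 1)` exactly.

To exploit it, `F` is linearized with one derivative `J` frozen at the left end of the cell. The
leading stage errors then enter the update as a weighted sum of multiples of one vector, which
vanishes. This leaves a local error `O(h ^ (N + 3))` (`exists_step_bound`), and `Grid.gronwall`
turns it into a nodal error `O(Δt ^ (N + 2))`.

Inside a cell the stages are accurate only to order `N + 1`. The improved local solution integrates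
`F` of them, and the factor `h` in front of the integral restores the order `N + 2`; the local
solution interpolates the stages directly and stays at `N + 1`. -/

theorem intervalIntegrable_eval (P : ℝ[X]) (a b : ℝ) :
    IntervalIntegrable (fun x => P.eval x) volume a b :=
  P.continuous.intervalIntegrable a b

theorem integral_eval_derivative (P : ℝ[X]) (a b : ℝ) :
    ∫ x in a..b, (derivative P).eval x = P.eval b - P.eval a :=
  intervalIntegral.integral_eq_sub_of_hasDerivAt (fun x _ => P.hasDerivAt x)
    (intervalIntegrable_eval _ a b)

/-- Integration by parts for polynomials. -/
theorem integral_derivative_mul (P Q : ℝ[X]) (a b : ℝ) :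
    ∫ x in a..b, (derivative P * Q).eval x =
      (P * Q).eval b - (P * Q).eval a - ∫ x in a..b, (P * derivative Q).eval x := by
  rw [← integral_eval_derivative (P * Q), derivative_mul]
  simp only [eval_add]
  rw [intervalIntegral.integral_add (intervalIntegrable_eval _ _ _)
    (intervalIntegrable_eval _ _ _)]
  ring

/-- Each differentiation lowers the order of vanishing at `c` by at most one. -/
theorem eval_iterate_derivative_eq_zero {n k : ℕ} (hk : k < n) {W : ℝ[X]} {c : ℝ}
    (h : (X - C c) ^ n ∣ W) : (derivative^[k] W).eval c = 0 := by
  obtain ⟨V, rfl⟩ := h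
  induction k generalizing n V with
  | zero => simp [show n ≠ 0 by omega]
  | succ k ih =>
    obtain ⟨m, rfl⟩ : ∃ m, n = m + 1 := ⟨n - 1, by omega⟩
    have : derivative ((X - C c) ^ (m + 1) * V) =
        (X - C c) ^ m * (C ((m : ℝ) + 1) * V + (X - C c) * derivative V) := by
      rw [derivative_mul, derivative_X_sub_C_pow]
      simp
      ring
    rw [Function.iterate_succ_apply, this]
    exact ih (by omega) _

/-- Repeated integration by parts moves every derivative onto `q`, whose degree is too small to
survive; the boundary terms vanish because `W` has zeros of order `n` at both ends. -/
theorem integral_iterate_derivative_mul_eq_zero {n k : ℕ} (hk : k ≤ n) {W q : ℝ[X]}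
    (h0 : (X - C (0 : ℝ)) ^ n ∣ W) (h1 : (X - C (1 : ℝ)) ^ n ∣ W) (hq : q.degree < k) :
    ∫ x in (0 : ℝ)..1, (derivative^[k] W * q).eval x = 0 := by
  induction k generalizing q with
  | zero =>
    have : q = 0 := by simpa using hq
    simp [this]
  | succ k ih =>
    rw [Function.iterate_succ_apply', integral_derivative_mul, ih (by omega)]
    · simp only [eval_mul, eval_iterate_derivative_eq_zero (show k < n by omega) h0,
        eval_iterate_derivative_eq_zero (show k < n by omega) h1]
      simp
    · by_cases h : q = 0
      · simp [h]
      · have h1 := degree_derivative_lt h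
        rw [degree_eq_natDegree h] at hq h1
        refine h1.trans_le ?_
        norm_cast at hq ⊢
        omega

theorem degree_legendre (n : ℕ) : (legendre n).degree = n := by
  rw [legendre, degree_map_eq_of_injective (RingHom.injective_int _), degree_shiftedLegendre]

theorem legendre_ne_zero (n : ℕ) : legendre n ≠ 0 := by
  intro h
  simpa [h] using degree_legendre n

/-- Rodrigues' formula, the source of orthogonality to all polynomials of lower degree. -/
theorem factorial_mul_legendre (n : ℕ) :
    C (n.factorial : ℝ) * legendre n = derivative^[n] (X ^ n * (1 - X) ^ n) := by
  have := congrArg (Polynomial.map (Int.castRingHom ℝ)) (factorial_mul_shiftedLegendre_eq n)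
  simpa [legendre, ← Polynomial.iterate_derivative_map] using this

theorem integral_legendre_mul_eq_zero {n : ℕ} {q : ℝ[X]} (hq : q.degree < n) :
    ∫ x in (0 : ℝ)..1, (legendre n * q).eval x = 0 := by
  have h := integral_iterate_derivative_mul_eq_zero (le_refl n) (q := q)
    (W := X ^ n * (1 - X) ^ n) (by simp) ?_ hq
  · rw [← factorial_mul_legendre, mul_assoc] at h
    simp only [eval_C_mul, intervalIntegral.integral_const_mul] at h
    exact (mul_eq_zero.1 h).resolve_left (by positivity)
  · refine Dvd.dvd.mul_left (pow_dvd_pow_of_dvd ⟨-1, ?_⟩ n) _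
    simp

theorem eq_zero_of_integral_eq_zero {P : ℝ[X]} (h0 : ∀ x ∈ Icc (0 : ℝ) 1, 0 ≤ P.eval x)
    (h : ∫ x in (0 : ℝ)..1, P.eval x = 0) : P = 0 := by
  have hz : ∀ x ∈ Icc (0 : ℝ) 1, P.eval x = 0 := by
    by_contra! hc
    obtain ⟨x, hx, hne⟩ := hc
    exact (intervalIntegral.integral_pos zero_lt_one P.continuousOn
      (fun y hy => h0 y ⟨hy.1.le, hy.2⟩) ⟨x, hx, lt_of_le_of_ne (h0 x hx) hne.symm⟩).ne' h
  exact eq_zero_of_infinite_isRoot P ((Icc_infinite zero_lt_one).mono hz)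

/-- A factor of the Legendre polynomial that does not change sign on `[0, 1]` is constant. -/
theorem degree_le_zero_of_dvd_legendre {n : ℕ} {d : ℝ[X]} (hd : d ∣ legendre n)
    (hs : (∀ x ∈ Icc (0 : ℝ) 1, 0 ≤ d.eval x) ∨ ∀ x ∈ Icc (0 : ℝ) 1, d.eval x ≤ 0) :
    d.degree ≤ 0 := by
  obtain ⟨m, hm⟩ := hd
  have hne := legendre_ne_zero n
  have hd0 : d ≠ 0 := by rintro rfl; simp [hm] at hne
  have hm0 : m ≠ 0 := by rintro rfl; simp [hm] at hne
  by_contra! hdeg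
  -- If `d` were not constant, the cofactor `m` would have degree below `n` and be orthogonal to the
  -- Legendre polynomial `d * m`. But `d * m * m` has constant sign on the interval, so it would
  -- vanish identically.
  have hlt : m.degree < n := by
    rw [← degree_legendre, hm, degree_mul]
    rw [degree_eq_natDegree hd0] at hdeg ⊢
    rw [degree_eq_natDegree hm0]
    norm_cast at hdeg ⊢
    omega
  have hint := integral_legendre_mul_eq_zero hlt
  rw [hm] at hint
  have key : d * m * m = 0 := by
    rcases hs with hs | hs
    · refine eq_zero_of_integral_eq_zero (fun x hx => ?_) hint
      simp only [eval_mul, mul_assoc]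
      exact mul_nonneg (hs x hx) (mul_self_nonneg _)
    · rw [← neg_eq_zero]
      refine eq_zero_of_integral_eq_zero (fun x hx => ?_) (by simpa using hint)
      simp only [eval_neg, eval_mul, mul_assoc, Left.nonneg_neg_iff]
      exact mul_nonpos_of_nonpos_of_nonneg (hs x hx) (mul_self_nonneg _)
  simp [hd0, hm0] at key

theorem constant_sign_of_no_root {d : ℝ[X]} (h : ∀ x, d.eval x ≠ 0) :
    (∀ x, 0 ≤ d.eval x) ∨ ∀ x, d.eval x ≤ 0 := by
  by_contra! hc
  obtain ⟨⟨x, hx⟩, y, hy⟩ := hc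
  obtain ⟨z, hz⟩ := mem_range_of_exists_le_of_exists_ge d.continuous ⟨x, hx.le⟩ ⟨y, hy.le⟩
  exact h z hz

/-- An irreducible factor without a real root has constant sign, hence would be constant; so every
irreducible factor is linear. The same sign criterion, applied to `X - C x` with `x` outside the
open interval and to `(X - C x) ^ 2`, puts the roots in the interior and makes them simple. -/
theorem splits_legendre (n : ℕ) : (legendre n).Splits := by
  have hlin : ∀ d : ℝ[X], Irreducible d → d ∣ legendre n → d.degree = 1 := by
    intro d hirr hd
    by_cases h : ∃ x, d.eval x = 0
    · obtain ⟨x, hx⟩ := h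
      exact degree_eq_one_of_irreducible_of_root hirr hx
    · push Not at h
      have := degree_le_zero_of_dvd_legendre hd ((constant_sign_of_no_root h).imp
        (fun h x _ => h x) (fun h x _ => h x))
      exact absurd this (not_le.2 (degree_pos_of_irreducible hirr))
  obtain ⟨v, hv⟩ := UniqueFactorizationMonoid.factors_prod (legendre_ne_zero n)
  rw [← hv]
  refine (Splits.multisetProd fun d hd => ?_).mul v.isUnit.splits
  exact Splits.of_degree_eq_one (hlin d (UniqueFactorizationMonoid.irreducible_of_factor d hd)
    (UniqueFactorizationMonoid.dvd_of_mem_factors hd))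

theorem mem_Ioo_of_mem_roots_legendre {n : ℕ} {x : ℝ} (hx : x ∈ (legendre n).roots) :
    x ∈ Ioo (0 : ℝ) 1 := by
  by_contra hc
  have h := degree_le_zero_of_dvd_legendre (dvd_iff_isRoot.2 (isRoot_of_mem_roots hx)) ?_
  · rw [degree_X_sub_C] at h
    norm_cast at h
  · simp only [mem_Ioo, not_and_or, not_lt] at hc
    rcases hc with hc | hc
    · exact Or.inl fun y hy => by simp; linarith [hy.1]
    · exact Or.inr fun y hy => by simp; linarith [hy.2]

theorem nodup_roots_legendre (n : ℕ) : (legendre n).roots.Nodup := by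
  classical
  refine Multiset.nodup_iff_count_le_one.2 fun x => ?_
  rw [count_roots]
  by_contra! hc
  have hd : (X - C x) ^ 2 ∣ legendre n :=
    (pow_dvd_pow _ hc).trans (pow_rootMultiplicity_dvd _ _)
  have := degree_le_zero_of_dvd_legendre hd
    (Or.inl fun y _ => by simp only [eval_pow]; positivity)
  rw [degree_pow, degree_X_sub_C] at this
  norm_cast at this

theorem card_roots_legendre (n : ℕ) : (legendre n).roots.toFinset.card = n := by
  rw [Multiset.toFinset_card_of_nodup (nodup_roots_legendre n),
    ← (splits_legendre n).natDegree_eq_card_roots,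
    natDegree_eq_of_degree_eq_some (degree_legendre n)]

theorem length_sort_roots_legendre (n : ℕ) :
    ((legendre n).roots.toFinset.sort (· ≤ ·)).length = n := by
  rw [Finset.length_sort, card_roots_legendre]

theorem node_eq_getElem (N : ℕ) (k : Fin (N + 1)) :
    node N k = ((legendre (N + 1)).roots.toFinset.sort (· ≤ ·))[(k : ℕ)]'(by
      rw [length_sort_roots_legendre]; exact k.2) := by
  rw [node, List.getD_eq_getElem]

theorem node_mem_roots (N : ℕ) (k : Fin (N + 1)) : node N k ∈ (legendre (N + 1)).roots := by
  rw [node_eq_getElem, ← Multiset.mem_toFinset, ← Finset.mem_sort (· ≤ ·)]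
  exact List.getElem_mem _

theorem node_mem_Ioo (N : ℕ) (k : Fin (N + 1)) : node N k ∈ Ioo (0 : ℝ) 1 :=
  mem_Ioo_of_mem_roots_legendre (node_mem_roots N k)

theorem node_injective (N : ℕ) : Function.Injective (node N) := by
  intro i j h
  rw [node_eq_getElem, node_eq_getElem] at h
  exact Fin.ext ((List.Nodup.getElem_inj_iff (Finset.sort_nodup _ _)).1 h)

/-- The nodes exhaust the roots of the Legendre polynomial, which are simple, so vanishing at the
nodes suffices for divisibility. -/
theorem nodal_dvd_of_eval_node_eq_zero {N : ℕ} {P : ℝ[X]} (h : ∀ k, P.eval (node N k) = 0) :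
    legendre (N + 1) ∣ P := by
  by_cases hP : P = 0
  · simp [hP]
  refine (splits_legendre _).dvd_of_roots_le_roots (legendre_ne_zero _) ?_
  refine (Multiset.le_iff_subset (nodup_roots_legendre _)).2 fun x hx => ?_
  have himg : Finset.univ.image (node N) = (legendre (N + 1)).roots.toFinset := by
    refine Finset.eq_of_subset_of_card_le (fun y hy => ?_) ?_
    · obtain ⟨k, -, rfl⟩ := Finset.mem_image.1 hy
      exact Multiset.mem_toFinset.2 (node_mem_roots N k)
    · rw [card_roots_legendre, Finset.card_image_of_injective _ (node_injective N)]
      simp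
  obtain ⟨k, -, rfl⟩ := Finset.mem_image.1 (himg ▸ Multiset.mem_toFinset.2 hx)
  exact (mem_roots hP).2 (h k)

/-! ### Lagrange interpolation at the Gauss nodes and exactness of the quadrature. -/

theorem eval_phi_node (N : ℕ) (p q : Fin (N + 1)) :
    (phi N p).eval (node N q) = if p = q then 1 else 0 := by
  split_ifs with h
  · subst h
    exact Lagrange.eval_basis_self (node_injective N).injOn (Finset.mem_univ _)
  · exact Lagrange.eval_basis_of_ne h (Finset.mem_univ _)

theorem degree_phi (N : ℕ) (p : Fin (N + 1)) : (phi N p).degree = N := by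
  rw [phi, Lagrange.degree_basis (node_injective N).injOn (Finset.mem_univ _)]
  simp

theorem degree_sum_C_mul_phi_le {N : ℕ} (a : Fin (N + 1) → ℝ) :
    (∑ p, C (a p) * phi N p).degree ≤ N := by
  refine (degree_sum_le _ _).trans (Finset.sup_le fun p _ => ?_)
  rw [degree_mul, degree_phi]
  exact add_le_of_nonpos_left degree_C_le

/-- A polynomial of degree at most `N` is the combination of the basis polynomials with its values
at the nodes as coefficients. -/
theorem sum_eval_node_phi {N : ℕ} {P : ℝ[X]} (hP : P.degree ≤ N) :
    ∑ p, C (P.eval (node N p)) * phi N p = P := by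
  have h := Lagrange.eq_interpolate (s := Finset.univ) (f := P) (node_injective N).injOn (by
    rw [Finset.card_univ, Fintype.card_fin]
    exact hP.trans_lt (by norm_cast; omega))
  rw [Lagrange.interpolate_apply] at h
  exact h.symm

theorem sum_eval_phi_mul {N : ℕ} {P : ℝ[X]} (hP : P.degree ≤ N) (x : ℝ) :
    ∑ p, (phi N p).eval x * P.eval (node N p) = P.eval x := by
  conv_rhs => rw [← sum_eval_node_phi hP]
  simp [eval_finsetSum, mul_comm]

theorem integral_mul_sum (N : ℕ) (Q : ℝ[X]) (a : Fin (N + 1) → ℝ) (s t : ℝ) :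
    ∫ x in s..t, (Q * ∑ p, C (a p) * phi N p).eval x =
      ∑ p, (∫ x in s..t, Q.eval x * (phi N p).eval x) * a p := by
  simp only [Finset.mul_sum, eval_finsetSum]
  rw [intervalIntegral.integral_finsetSum fun p _ => intervalIntegrable_eval _ _ _]
  refine Finset.sum_congr rfl fun p _ => ?_
  rw [← intervalIntegral.integral_mul_const]
  congr 1 with x
  simp
  ring

theorem sum_weight_mul {N : ℕ} {P : ℝ[X]} (hP : P.degree ≤ N) :
    ∑ p, weight N p * P.eval (node N p) = ∫ x in (0 : ℝ)..1, P.eval x := by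
  conv_rhs => rw [← sum_eval_node_phi hP]
  have := integral_mul_sum N 1 (fun p => P.eval (node N p)) 0 1
  simp only [one_mul, eval_one] at this
  rw [this]
  rfl

/-- Gauss quadrature with `N + 1` nodes is exact for polynomials of degree at most `2 N + 1`. -/
theorem sum_weight_mul_of_degree_le {N : ℕ} {P : ℝ[X]} (hP : P.natDegree ≤ 2 * N + 1) :
    ∑ p, weight N p * P.eval (node N p) = ∫ x in (0 : ℝ)..1, P.eval x := by
  set I := ∑ p, C (P.eval (node N p)) * phi N p with hI
  have hIn : ∀ k, I.eval (node N k) = P.eval (node N k) := fun k => by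
    simp [hI, eval_finsetSum, eval_phi_node]
  have hId : I.degree ≤ N := degree_sum_C_mul_phi_le _
  -- The interpolation error is the Legendre polynomial times a quotient of degree at most `N`, so
  -- its integral is zero by orthogonality.
  obtain ⟨q, hq⟩ := nodal_dvd_of_eval_node_eq_zero (N := N) (P := P - I) (fun k => by simp [hIn])
  have hqd : q.degree < (N + 1 : ℕ) := by
    by_cases hq0 : q = 0
    · simp [hq0]
    have h1 : (P - I).natDegree ≤ 2 * N + 1 :=
      (natDegree_sub_le _ _).trans (max_le hP ((natDegree_le_of_degree_le hId).trans (by omega)))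
    rw [hq, natDegree_mul (legendre_ne_zero _) hq0,
      natDegree_eq_of_degree_eq_some (degree_legendre _)] at h1
    rw [degree_eq_natDegree hq0]
    norm_cast
    omega
  have h0 := integral_legendre_mul_eq_zero hqd
  rw [← hq] at h0
  simp only [eval_sub] at h0
  rw [intervalIntegral.integral_sub (intervalIntegrable_eval _ _ _)
    (intervalIntegrable_eval _ _ _), sub_eq_zero] at h0
  rw [h0, ← sum_weight_mul hId]
  simp only [hIn]

/-! ### The matrices `K`, `M`, `A` acting on nodal values of polynomials. -/

theorem sum_matM_mul {N : ℕ} {P : ℝ[X]} (hP : P.degree ≤ N) (p : Fin (N + 1)) :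
    ∑ q, matM N p q * P.eval (node N q) = ∫ x in (0 : ℝ)..1, (phi N p * P).eval x := by
  conv_rhs => rw [← sum_eval_node_phi hP]
  rw [integral_mul_sum]
  rfl

theorem sum_matK_mul {N : ℕ} {P : ℝ[X]} (hP : P.degree ≤ N) (p : Fin (N + 1)) :
    ∑ q, matK N p q * P.eval (node N q) = (phi N p).eval 1 * P.eval 1 -
      ∫ x in (0 : ℝ)..1, (derivative (phi N p) * P).eval x := by
  conv_rhs => rw [← sum_eval_node_phi hP]
  rw [integral_mul_sum]
  simp only [matK, Matrix.of_apply, sub_mul, Finset.sum_sub_distrib, eval_finsetSum,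
    Finset.mul_sum]
  congr 1
  refine Finset.sum_congr rfl fun q _ => ?_
  simp
  ring

theorem sum_mul_matK {N : ℕ} {P : ℝ[X]} (hP : P.degree ≤ N) (q : Fin (N + 1)) :
    ∑ p, P.eval (node N p) * matK N p q = P.eval 1 * (phi N q).eval 1 -
      ∫ x in (0 : ℝ)..1, (derivative P * phi N q).eval x := by
  have h1 : derivative P = ∑ p, C (P.eval (node N p)) * derivative (phi N p) := by
    conv_lhs => rw [← sum_eval_node_phi hP]
    simp
  simp only [h1, Finset.sum_mul, eval_finsetSum]
  rw [intervalIntegral.integral_finsetSum fun p _ => intervalIntegrable_eval _ _ _]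
  rw [← sum_eval_phi_mul hP 1, Finset.sum_mul, ← Finset.sum_sub_distrib]
  refine Finset.sum_congr rfl fun p _ => ?_
  simp only [matK, Matrix.of_apply, mul_sub, eval_mul, eval_C, mul_assoc,
    intervalIntegral.integral_const_mul]
  ring

/-- A left null vector is the nodal vector of some `P` with `P(1) Q(1) = ∫ P' Q` for all `Q` of
degree at most `N`. The choice `Q = P` forces `P(1) ^ 2 + P(0) ^ 2 = 0`; the choice `Q = P'` then
gives `∫ P' ^ 2 = 0`, so `P` is a constant vanishing at 1. -/
theorem isUnit_det_matK (N : ℕ) : IsUnit (matK N).det := by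
  rw [isUnit_iff_ne_zero]
  intro hdet
  obtain ⟨a, ha0, ha⟩ := Matrix.exists_vecMul_eq_zero_iff.2 hdet
  set P := ∑ p, C (a p) * phi N p with hPdef
  have hPd : P.degree ≤ N := degree_sum_C_mul_phi_le _
  have hPn : ∀ k, P.eval (node N k) = a k := fun k => by
    simp [hPdef, eval_finsetSum, eval_phi_node]
  have hk : ∀ Q : ℝ[X], Q.degree ≤ N →
      P.eval 1 * Q.eval 1 = ∫ x in (0 : ℝ)..1, (derivative P * Q).eval x := by
    intro Q hQ
    have hq : ∀ q, P.eval 1 * (phi N q).eval 1 =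
        ∫ x in (0 : ℝ)..1, (derivative P).eval x * (phi N q).eval x := fun q => by
      have h := sum_mul_matK hPd q
      have h' : ∑ p, a p * matK N p q = 0 := congrFun ha q
      simp only [hPn, h'] at h
      simp only [eval_mul] at h
      linarith
    conv_rhs => rw [← sum_eval_node_phi hQ]
    rw [integral_mul_sum, ← sum_eval_phi_mul hQ 1, Finset.mul_sum]
    refine Finset.sum_congr rfl fun q _ => ?_
    rw [← hq]
    ring
  have h1 := hk P hPd
  have h2 := integral_derivative_mul P P 0 1
  simp only [mul_comm P (derivative P)] at h2
  simp only [eval_mul] at h1 h2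
  have hP1 : P.eval 1 = 0 := by nlinarith [mul_self_nonneg (P.eval 1), mul_self_nonneg (P.eval 0)]
  have h3 := hk (derivative P) ((degree_derivative_le).trans hPd)
  rw [hP1, zero_mul] at h3
  have h4 := eq_zero_of_integral_eq_zero (P := derivative P * derivative P)
    (fun x _ => by rw [eval_mul]; exact mul_self_nonneg _) h3.symm
  have h5 : derivative P = 0 := by simpa using h4
  have h6 := eq_C_of_derivative_eq_zero h5
  have h7 : P = 0 := by
    rw [h6] at hP1 ⊢
    simpa using hP1
  exact ha0 (funext fun k => by rw [← hPn, h7]; simp)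

/-- The matrix `A` integrates polynomials of degree less than `N` exactly. -/
theorem sum_matA_mul {N : ℕ} {P : ℝ[X]} (hP : P.degree ≤ N) (p : Fin (N + 1)) :
    ∑ q, matA N p q * (derivative P).eval (node N q) = P.eval (node N p) - P.eval 0 := by
  -- This is integration by parts; subtracting `P(0)` removes the boundary term at 0, which `matK`
  -- does not contain.
  have hM : Matrix.mulVec (matM N) (fun q => (derivative P).eval (node N q)) =
      Matrix.mulVec (matK N) (fun q => (P - C (P.eval 0)).eval (node N q)) := by
    funext r
    have h1 := sum_matM_mul ((degree_derivative_le (p := P)).trans hP) r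
    have hP' : (P - C (P.eval 0)).degree ≤ N :=
      (degree_sub_le _ _).trans (max_le hP (degree_C_le.trans (by norm_cast; omega)))
    have h2 := sum_matK_mul hP' r
    have h3 := integral_derivative_mul (phi N r) (P - C (P.eval 0)) 0 1
    simp only [derivative_sub, derivative_C, sub_zero] at h3
    simp only [Matrix.mulVec, dotProduct]
    rw [h1, h2, h3]
    simp
  have : Matrix.mulVec (matA N) (fun q => (derivative P).eval (node N q)) =
      fun q => (P - C (P.eval 0)).eval (node N q) := by
    rw [matA, ← Matrix.mulVec_mulVec, hM, Matrix.mulVec_mulVec,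
      Matrix.nonsing_inv_mul _ (isUnit_det_matK N), Matrix.one_mulVec]
  simpa [Matrix.mulVec, dotProduct] using congrFun this p

/-- The weights satisfy `wᵀ A = (1 - τ)ᵀ M`. -/
theorem sum_weight_mul_sum_matA {N : ℕ} (hN : 1 ≤ N) {P : ℝ[X]} (hP : P.degree ≤ N) :
    ∑ p, weight N p * ∑ q, matA N p q * P.eval (node N q) =
      ∫ x in (0 : ℝ)..1, ((1 - X) * P).eval x := by
  have hd : (1 - X : ℝ[X]).degree ≤ N := by
    refine (degree_sub_le _ _).trans (max_le ?_ ?_)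
    · exact degree_one_le.trans (by norm_cast; omega)
    · exact degree_X_le.trans (by exact_mod_cast hN)
  -- The polynomial `1 - X` vanishes at 1 and has derivative `-1`, so its row product with `K` is
  -- the vector of integrals of the basis functions. It must have degree at most `N`, which is where
  -- `1 ≤ N` enters.
  have hK : Matrix.vecMul (fun p => (1 - X : ℝ[X]).eval (node N p)) (matK N) = weight N := by
    funext q
    have := sum_mul_matK hd q
    simp only [Matrix.vecMul, dotProduct]
    rw [this]
    simp [weight]
  have hA : Matrix.vecMul (weight N) (matA N) =
      Matrix.vecMul (fun p => (1 - X : ℝ[X]).eval (node N p)) (matM N) := by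
    rw [matA, ← hK, Matrix.vecMul_vecMul, ← Matrix.mul_assoc,
      Matrix.mul_nonsing_inv _ (isUnit_det_matK N), Matrix.one_mul]
  have h1 : ∑ p, weight N p * ∑ q, matA N p q * P.eval (node N q) =
      dotProduct (weight N) (Matrix.mulVec (matA N) fun q => P.eval (node N q)) := rfl
  rw [h1, Matrix.dotProduct_mulVec, hA, ← Matrix.dotProduct_mulVec]
  have h2 : Matrix.mulVec (matM N) (fun q => P.eval (node N q)) =
      fun p => ∫ x in (0 : ℝ)..1, (phi N p * P).eval x := funext fun p => sum_matM_mul hP p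
  rw [h2]
  simp only [dotProduct]
  conv_rhs => rw [← sum_eval_node_phi hd, mul_comm, integral_mul_sum]
  refine Finset.sum_congr rfl fun p _ => ?_
  rw [mul_comm]
  simp only [eval_mul, mul_comm (eval _ (phi N p))]

end

/-! ### Grids, piecewise assembly, nodal matching and continuity. -/

section

namespace Grid

variable {t₀ tf : ℝ} {M : ℕ}

theorem step_pos (g : Grid t₀ tf M) (n : Fin M) : 0 < g.step n :=
  sub_pos.2 (g.strictMono (Fin.castSucc_lt_succ))

theorem step_le_mesh (g : Grid t₀ tf M) (n : Fin M) : g.step n ≤ g.mesh :=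
  le_ciSup (f := g.step) (Set.finite_range _).bddAbove n

theorem pt_mem_Icc (g : Grid t₀ tf M) (n : Fin (M + 1)) : g.pt n ∈ Icc t₀ tf := by
  exact ⟨g.first.symm.le.trans (g.strictMono.monotone (Fin.zero_le n)),
    (g.strictMono.monotone (Fin.le_last n)).trans g.last.le⟩

theorem time_mem_Icc (g : Grid t₀ tf M) (n : Fin M) {τ : ℝ} (hτ : τ ∈ Icc (0 : ℝ) 1) :
    g.time n τ ∈ Icc t₀ tf := by
  have h1 := (g.pt_mem_Icc n.castSucc).1
  have h2 := (g.pt_mem_Icc n.succ).2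
  have h3 := (g.step_pos n).le
  have h4 : g.pt n.succ = g.pt n.castSucc + g.step n := by rw [step]; ring
  have h5 := mul_nonneg hτ.1 h3
  have h6 := mul_le_mul_of_nonneg_right hτ.2 h3
  constructor <;> rw [time] <;> linarith

theorem cell_subset (g : Grid t₀ tf M) (n : Fin M) :
    g.cell n ⊆ Icc (g.pt n.castSucc) (g.pt n.succ) := by
  rw [cell]
  split_ifs
  · exact Subset.rfl
  · exact Ico_subset_Icc_self

theorem cell_disjoint_of_lt (g : Grid t₀ tf M) {n m : Fin M} (h : n < m) {t : ℝ}
    (hn : t ∈ g.cell n) (hm : t ∈ g.cell m) : False := by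
  have hne : (n : ℕ) + 1 ≠ M := by have := m.2; have : (n : ℕ) < m := h; omega
  rw [cell, if_neg hne] at hn
  have h1 : g.pt n.succ ≤ g.pt m.castSucc := g.strictMono.monotone (Fin.succ_le_castSucc_iff.2 h)
  linarith [hn.2, (g.cell_subset m hm).1]

theorem assemble_of_mem_cell {D : ℕ} (g : Grid t₀ tf M) (v : Fin M → ℝ → Fin D → ℝ) {n : Fin M}
    {t : ℝ} (ht : t ∈ g.cell n) :
    g.assemble v t = v n ((t - g.pt n.castSucc) / g.step n) := by
  rw [assemble, Finset.sum_eq_single n]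
  · rw [indicator_of_mem ht]
  · intro m _ hm
    refine indicator_of_notMem (fun htm => ?_) _
    rcases lt_or_gt_of_ne hm with h | h
    · exact g.cell_disjoint_of_lt h htm ht
    · exact g.cell_disjoint_of_lt h ht htm
  · simp

theorem castSucc_mem_cell (g : Grid t₀ tf M) (n : Fin M) : g.pt n.castSucc ∈ g.cell n := by
  have h : g.pt n.castSucc < g.pt n.succ := g.strictMono Fin.castSucc_lt_succ
  rw [cell]
  split_ifs
  · exact ⟨le_rfl, h.le⟩
  · exact ⟨le_rfl, h⟩

theorem exists_mem_cell (g : Grid t₀ tf M) (h : t₀ < tf) {t : ℝ} (ht : t ∈ Icc t₀ tf) :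
    ∃ n, t ∈ g.cell n := by
  have hM : M ≠ 0 := by
    rintro rfl
    exact h.ne (g.first.symm.trans g.last)
  obtain ⟨K, rfl⟩ := Nat.exists_eq_succ_of_ne_zero hM
  have hS : (Finset.univ.filter fun n : Fin (K + 1) => g.pt n.castSucc ≤ t).Nonempty :=
    ⟨0, by simpa [g.first] using ht.1⟩
  -- The cell containing `t` is the last one whose left end does not exceed `t`.
  set n := Finset.max' _ hS with hn
  have hnt : g.pt n.castSucc ≤ t := (Finset.mem_filter.1 (Finset.max'_mem _ hS)).2
  refine ⟨n, ?_⟩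
  rw [cell]
  split_ifs with hl
  · have : n.succ = Fin.last (K + 1) := Fin.ext (by simpa using hl)
    exact ⟨hnt, by rw [this, g.last]; exact ht.2⟩
  · refine ⟨hnt, ?_⟩
    by_contra! hc
    have hlt : (n : ℕ) + 1 < K + 1 := by have := n.2; omega
    have := Finset.le_max' (Finset.univ.filter fun n : Fin (K + 1) => g.pt n.castSucc ≤ t)
      ⟨n + 1, hlt⟩ (Finset.mem_filter.2 ⟨Finset.mem_univ _, hc⟩)
    rw [← hn, Fin.le_def] at this
    simp at this

theorem div_step_mem_Icc (g : Grid t₀ tf M) {n : Fin M} {t : ℝ}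
    (ht : t ∈ Icc (g.pt n.castSucc) (g.pt n.succ)) :
    (t - g.pt n.castSucc) / g.step n ∈ Icc (0 : ℝ) 1 := by
  have h := g.step_pos n
  refine ⟨div_nonneg (by linarith [ht.1]) h.le, ?_⟩
  rw [div_le_one h, step]
  linarith [ht.2]

theorem time_div_step (g : Grid t₀ tf M) (n : Fin M) (t : ℝ) :
    g.time n ((t - g.pt n.castSucc) / g.step n) = t := by
  rw [time, div_mul_cancel₀ _ (g.step_pos n).ne']
  ring

theorem iUnion_Icc (g : Grid t₀ tf M) (h : t₀ < tf) :
    Icc t₀ tf ⊆ ⋃ n : Fin M, Icc (g.pt n.castSucc) (g.pt n.succ) := fun _ ht =>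
  let ⟨n, hn⟩ := g.exists_mem_cell h ht
  mem_iUnion.2 ⟨n, g.cell_subset n hn⟩

end Grid

variable {D N M : ℕ} {t₀ tf : ℝ}

theorem localSol_node (Q : Fin M → Fin (N + 1) → Fin D → ℝ) (n : Fin M) (p : Fin (N + 1)) :
    localSol Q n (node N p) = Q n p := by
  simp [localSol, eval_phi_node]

theorem improvedLocalSol_eq (F : (Fin D → ℝ) → ℝ → Fin D → ℝ) (g : Grid t₀ tf M)
    (U : Fin (M + 1) → Fin D → ℝ) (Q : Fin M → Fin (N + 1) → Fin D → ℝ) (n : Fin M) (τ : ℝ) :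
    improvedLocalSol F g U Q n τ = U n.castSucc + g.step n •
      ∑ p, (∫ ξ in (0 : ℝ)..τ, (phi N p).eval ξ) • F (Q n p) (g.time n (node N p)) := by
  rw [improvedLocalSol]
  simp only [pointwiseF]
  rw [intervalIntegral.integral_finsetSum]
  · simp only [intervalIntegral.integral_smul_const]
  · intro p _
    exact ((phi N p).continuous.smul continuous_const).intervalIntegrable _ _

theorem improvedLocalSol_zero (F : (Fin D → ℝ) → ℝ → Fin D → ℝ) (g : Grid t₀ tf M)
    (U : Fin (M + 1) → Fin D → ℝ) (Q : Fin M → Fin (N + 1) → Fin D → ℝ) (n : Fin M) :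
    improvedLocalSol F g U Q n 0 = U n.castSucc := by
  simp [improvedLocalSol]

theorem continuous_improvedLocalSol (F : (Fin D → ℝ) → ℝ → Fin D → ℝ) (g : Grid t₀ tf M)
    (U : Fin (M + 1) → Fin D → ℝ) (Q : Fin M → Fin (N + 1) → Fin D → ℝ) (n : Fin M) :
    Continuous (improvedLocalSol F g U Q n) := by
  have h : improvedLocalSol F g U Q n = fun τ => _ := funext (improvedLocalSol_eq F g U Q n)
  rw [h]
  refine continuous_const.add (.fun_const_smul (continuous_finsetSum _ fun p _ => ?_) _)
  exact (intervalIntegral.continuous_primitive (fun a b => intervalIntegrable_eval _ a b) 0).smul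
    continuous_const

variable {F : (Fin D → ℝ) → ℝ → Fin D → ℝ} {u₀ : Fin D → ℝ} {g : Grid t₀ tf M}
  {U : Fin (M + 1) → Fin D → ℝ} {Q : Fin M → Fin (N + 1) → Fin D → ℝ}

theorem IsSolution.improvedLocalSol_one (h : IsSolution F u₀ g U Q) (n : Fin M) :
    improvedLocalSol F g U Q n 1 = U n.succ := by
  rw [improvedLocalSol_eq, h.update]
  rfl

/-- The formula extends to the closed cell: at a right end that belongs to the next cell, the value
1 of the old parameter and the value 0 of the new one both give the nodal value. -/
theorem IsSolution.uIL_of_mem_Icc (h : IsSolution F u₀ g U Q) {n : Fin M} {t : ℝ}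
    (ht : t ∈ Icc (g.pt n.castSucc) (g.pt n.succ)) :
    uIL F g U Q t = improvedLocalSol F g U Q n ((t - g.pt n.castSucc) / g.step n) := by
  by_cases hc : t ∈ g.cell n
  · exact g.assemble_of_mem_cell _ hc
  · rw [Grid.cell] at hc
    split_ifs at hc with hl
    · exact absurd ht hc
    · have htn : t = g.pt n.succ := by
        refine le_antisymm ht.2 ?_
        by_contra! hlt
        exact hc ⟨ht.1, hlt⟩
      have hlt : (n : ℕ) + 1 < M := by have := n.2; omega
      have hm : n.succ = (⟨n + 1, hlt⟩ : Fin M).castSucc := Fin.ext rfl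
      have h1 : (t - g.pt n.castSucc) / g.step n = 1 := by
        rw [htn]
        exact div_self (g.step_pos n).ne'
      rw [h1, h.improvedLocalSol_one, htn, hm, uIL,
        g.assemble_of_mem_cell _ (g.castSucc_mem_cell _), sub_self, zero_div,
        improvedLocalSol_zero]

theorem IsSolution.uIL_pt (h : IsSolution F u₀ g U Q) (ht : t₀ < tf) (n : Fin (M + 1)) :
    uIL F g U Q (g.pt n) = U n := by
  have hlt : ∀ n : Fin M, g.pt n.castSucc ≤ g.pt n.succ := fun n =>
    g.strictMono.monotone Fin.castSucc_lt_succ.le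
  by_cases hn : n = 0
  · obtain ⟨m, hm⟩ := g.exists_mem_cell ht (g.pt_mem_Icc 0)
    have h0 : m.castSucc = 0 := by
      refine le_antisymm (g.strictMono.le_iff_le.1 (g.cell_subset m hm).1) (Fin.zero_le _)
    rw [hn, ← h0, h.uIL_of_mem_Icc ⟨le_rfl, hlt m⟩, sub_self, zero_div, improvedLocalSol_zero]
  · obtain ⟨m, rfl⟩ := Fin.exists_succ_eq.2 hn
    rw [h.uIL_of_mem_Icc ⟨hlt m, le_rfl⟩, ← h.improvedLocalSol_one]
    congr 1
    exact div_self (g.step_pos m).ne'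

theorem IsSolution.continuousOn_uIL (h : IsSolution F u₀ g U Q) (ht : t₀ < tf) :
    ContinuousOn (uIL F g U Q) (Icc t₀ tf) := by
  refine ContinuousOn.mono ?_ (g.iUnion_Icc ht)
  refine (locallyFinite_of_finite _).continuousOn_iUnion (fun n => isClosed_Icc) fun n => ?_
  refine ContinuousOn.congr (Continuous.continuousOn ?_) fun t ht => h.uIL_of_mem_Icc ht
  exact (continuous_improvedLocalSol F g U Q n).comp (by fun_prop)

end

/-! ### Uniform Taylor expansions, regularity of the solution, quadrature and interpolation defects.
-/

section

section Analysis

variable {E : Type*} [NormedAddCommGroup E] [NormedSpace ℝ E]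

theorem norm_sum_smul_le {ι : Type*} [Fintype ι] (a : ι → ℝ) (f : ι → E) {X : ℝ}
    (hf : ∀ i, ‖f i‖ ≤ X) : ‖∑ i, a i • f i‖ ≤ (∑ i, |a i|) * X := by
  refine (norm_sum_le _ _).trans ?_
  rw [Finset.sum_mul]
  refine Finset.sum_le_sum fun i _ => ?_
  rw [norm_smul, Real.norm_eq_abs]
  exact mul_le_mul_of_nonneg_left (hf i) (abs_nonneg _)

theorem add_mul_mem_Icc {a b t h θ : ℝ} (ht : t ∈ Icc a b) (hh : 0 ≤ h) (hth : t + h ∈ Icc a b)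
    (hθ : θ ∈ Icc (0 : ℝ) 1) : t + θ * h ∈ Icc a b := by
  have h1 := mul_nonneg hθ.1 hh
  have h2 := mul_le_mul_of_nonneg_right hθ.2 hh
  exact ⟨by linarith [ht.1], by linarith [hth.2]⟩

/-- Integrating an expansion of the derivative. -/
theorem norm_sub_sum_le_of_expansion {a b : ℝ} {u v : ℝ → E} {m : ℕ} {c : ℝ → ℕ → E} {B : ℝ}
    (hB : 0 ≤ B) (hu : ∀ t ∈ Icc a b, HasDerivWithinAt u (v t) (Icc a b) t)
    (hv : ∀ t ∈ Icc a b, ∀ s, 0 ≤ s → t + s ∈ Icc a b →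
      ‖v (t + s) - ∑ k ∈ Finset.range m, s ^ k • c t k‖ ≤ B * s ^ m)
    {t : ℝ} (ht : t ∈ Icc a b) {s : ℝ} (hs : 0 ≤ s) (hts : t + s ∈ Icc a b) :
    ‖u (t + s) - u t - ∑ k ∈ Finset.range m, (s ^ (k + 1) / (k + 1)) • c t k‖
      ≤ B * s ^ (m + 1) := by
  have hmem : ∀ σ ∈ Icc 0 s, t + σ ∈ Icc a b := fun σ hσ =>
    ⟨by linarith [ht.1, hσ.1], by linarith [hts.2, hσ.2]⟩
  have hd : ∀ σ ∈ Icc 0 s, HasDerivWithinAt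
      (fun σ => u (t + σ) - ∑ k ∈ Finset.range m, (σ ^ (k + 1) / (k + 1)) • c t k)
      (v (t + σ) - ∑ k ∈ Finset.range m, σ ^ k • c t k) (Icc 0 s) σ := by
    intro σ hσ
    refine HasDerivWithinAt.sub ?_ (HasDerivWithinAt.fun_sum fun k _ => ?_)
    · have h1 : HasDerivWithinAt (fun σ => t + σ) 1 (Icc 0 s) σ :=
        (hasDerivWithinAt_id σ _).const_add t
      have h2 := (hu (t + σ) (hmem σ hσ)).scomp σ h1 hmem
      rw [one_smul] at h2
      exact h2
    · have h2 : HasDerivAt (fun σ : ℝ => σ ^ (k + 1) / (k + 1)) (σ ^ k) σ := by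
        have h3 := (hasDerivAt_pow (k + 1) σ).div_const ((k : ℝ) + 1)
        rwa [Nat.add_sub_cancel, Nat.cast_succ,
          mul_div_cancel_left₀ _ (Nat.cast_add_one_ne_zero k)] at h3
      exact (h2.smul_const (c t k)).hasDerivWithinAt
  have hb : ∀ σ ∈ Icc 0 s, ‖v (t + σ) - ∑ k ∈ Finset.range m, σ ^ k • c t k‖ ≤ B * s ^ m :=
    fun σ hσ => (hv t ht σ hσ.1 (hmem σ hσ)).trans
      (mul_le_mul_of_nonneg_left (pow_le_pow_left₀ hσ.1 hσ.2 m) hB)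
  -- The mean value inequality on `[0, s]`, with the remainder of `v` as derivative, supplies the
  -- extra power of `s`.
  have := (convex_Icc 0 s).norm_image_sub_le_of_norm_hasDerivWithin_le hd hb
    (left_mem_Icc.2 hs) (right_mem_Icc.2 hs)
  simp only [add_zero, sub_zero, Real.norm_eq_abs, abs_of_nonneg hs] at this
  have h0 : ∑ k ∈ Finset.range m, ((0 : ℝ) ^ (k + 1) / (k + 1)) • c t k = 0 :=
    Finset.sum_eq_zero fun k _ => by simp
  rw [h0, sub_zero] at this
  calc _ = _ := by congr 1; abel
    _ ≤ _ := this
    _ = _ := by ring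

/-- Taylor expansion with a remainder that is uniform in the base point. -/
theorem exists_uniform_expansion {a b : ℝ} (hab : a < b) (m : ℕ) {v : ℝ → E}
    (hv : ContDiffOn ℝ m v (Icc a b)) :
    ∃ c : ℝ → ℕ → E, ∃ B, 0 ≤ B ∧ (∀ t ∈ Icc a b, ∀ k, ‖c t k‖ ≤ B) ∧
      ∀ t ∈ Icc a b, ∀ s, 0 ≤ s → t + s ∈ Icc a b →
        ‖v (t + s) - ∑ k ∈ Finset.range m, s ^ k • c t k‖ ≤ B * s ^ m := by
  induction m generalizing v with
  | zero =>
    obtain ⟨B, hB⟩ := isCompact_Icc.exists_bound_of_continuousOn hv.continuousOn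
    have hB0 : 0 ≤ B := (norm_nonneg _).trans (hB a (left_mem_Icc.2 hab.le))
    exact ⟨fun _ _ => 0, B, hB0, by simpa using fun _ _ _ => hB0,
      fun t _ s _ hts => by simpa using hB _ hts⟩
  | succ m ih =>
    have hd := (contDiffOn_succ_iff_derivWithin (uniqueDiffOn_Icc hab)).1
      (by exact_mod_cast hv : ContDiffOn ℝ ((m : WithTop ℕ∞) + 1) v (Icc a b))
    obtain ⟨c, B, hB0, hc, hexp⟩ := ih hd.2.2
    obtain ⟨V, hV⟩ := isCompact_Icc.exists_bound_of_continuousOn hv.continuousOn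
    -- The coefficients are those of the derivative integrated termwise, with `v t` as the new
    -- constant term; `V` bounds the latter.
    refine ⟨fun t k => k.casesOn (v t) fun j => (1 / ((j : ℝ) + 1)) • c t j, max B V,
      hB0.trans (le_max_left _ _), ?_, ?_⟩
    · intro t ht k
      cases k with
      | zero => exact (hV t ht).trans (le_max_right _ _)
      | succ j =>
        refine le_trans ?_ (le_max_left _ _)
        simp only [norm_smul, Real.norm_eq_abs]
        refine (mul_le_of_le_one_left (norm_nonneg _) ?_).trans (hc t ht j)
        rw [abs_of_nonneg (by positivity), div_le_one (by positivity)]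
        linarith [Nat.cast_nonneg (α := ℝ) j]
    · intro t ht s hs hts
      have h := norm_sub_sum_le_of_expansion hB0
        (fun t ht => (hd.1 t ht).hasDerivWithinAt) hexp ht hs hts
      rw [Finset.sum_range_succ']
      calc _ = ‖v (t + s) - v t - ∑ k ∈ Finset.range m, (s ^ (k + 1) / (k + 1)) • c t k‖ := by
            congr 1
            simp only [smul_smul, mul_one_div, pow_zero, one_smul]
            abel
        _ ≤ _ := h
        _ ≤ _ := mul_le_mul_of_nonneg_right (le_max_left _ _) (by positivity)

/-- A solution of an ordinary differential equation with a `C^m` right-hand side is `C^(m+1)`. -/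
theorem contDiffOn_solution {a b : ℝ} (hab : a < b) {F : E → ℝ → E} {u : ℝ → E} {m : ℕ}
    (hF : ContDiffOn ℝ m (fun z : E × ℝ => F z.1 z.2) (univ ×ˢ Icc a b))
    (hu : ∀ t ∈ Icc a b, HasDerivWithinAt u (F (u t) t) (Icc a b) t) :
    ContDiffOn ℝ ((m + 1 : ℕ) : WithTop ℕ∞) u (Icc a b) := by
  have hdiff : DifferentiableOn ℝ u (Icc a b) := fun t ht => (hu t ht).differentiableWithinAt
  have hder : ∀ t ∈ Icc a b, derivWithin u (Icc a b) t = F (u t) t := fun t ht =>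
    (hu t ht).derivWithin (uniqueDiffOn_Icc hab t ht)
  -- Bootstrapping: if `u` is `C^k`, so is its derivative `F (u t) t`, hence `u` is `C^(k+1)`.
  have key : ∀ k : ℕ, k ≤ m → ContDiffOn ℝ k u (Icc a b) →
      ContDiffOn ℝ ((k + 1 : ℕ) : WithTop ℕ∞) u (Icc a b) := by
    intro k hk huk
    rw [Nat.cast_add, Nat.cast_one, contDiffOn_succ_iff_derivWithin (uniqueDiffOn_Icc hab)]
    refine ⟨hdiff, fun h => absurd h (by simp), ContDiffOn.congr ?_ hder⟩
    exact (hF.of_le (by exact_mod_cast hk)).comp (huk.prodMk contDiffOn_id)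
      fun t ht => ⟨mem_univ _, ht⟩
  have : ∀ k : ℕ, k ≤ m + 1 → ContDiffOn ℝ k u (Icc a b) := by
    intro k
    induction k with
    | zero => exact fun _ => contDiffOn_zero.2 hdiff.continuousOn
    | succ k ih => exact fun hk => key k (by omega) (ih (by omega))
  exact this (m + 1) le_rfl

/-- A second order bound for a `C^2` function, uniform on bounded sets. -/
theorem exists_second_order_bound [ProperSpace E] {E' : Type*} [NormedAddCommGroup E']
    [NormedSpace ℝ E'] {a b : ℝ} (hab : a < b) {G : E × ℝ → E'}
    (hG : ContDiffOn ℝ 2 G (univ ×ˢ Icc a b)) (R : ℝ) :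
    ∃ K, 0 ≤ K ∧ ∀ z₀ : E × ℝ, z₀ ∈ Metric.closedBall (0 : E) R ×ˢ Icc a b →
      ∃ J : E × ℝ →L[ℝ] E', ∀ z ∈ Metric.closedBall (0 : E) R ×ˢ Icc a b,
        ∀ z' ∈ Metric.closedBall (0 : E) R ×ˢ Icc a b, ∀ r, ‖z - z₀‖ ≤ r → ‖z' - z₀‖ ≤ r →
          ‖G z' - G z - J (z' - z)‖ ≤ K * r * ‖z' - z‖ := by
  set S : Set (E × ℝ) := univ ×ˢ Icc a b with hS
  set T : Set (E × ℝ) := Metric.closedBall (0 : E) R ×ˢ Icc a b with hT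
  have hTS : T ⊆ S := prod_mono (subset_univ _) Subset.rfl
  have huS : UniqueDiffOn ℝ S := uniqueDiffOn_univ.prod (uniqueDiffOn_Icc hab)
  have hTc : IsCompact T := (isCompact_closedBall _ _).prod isCompact_Icc
  have hTconv : Convex ℝ T := (convex_closedBall _ _).prod (convex_Icc _ _)
  have h1 := (contDiffOn_succ_iff_fderivWithin (n := 1) huS).1
    (by simpa [one_add_one_eq_two] using hG)
  have h2 := (contDiffOn_succ_iff_fderivWithin (n := 0) huS).1 (by simpa using h1.2.2)
  obtain ⟨K, hK⟩ := hTc.exists_bound_of_continuousOn (h2.2.2.continuousOn.mono hTS)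
  refine ⟨max K 0, le_max_right _ _, fun z₀ hz₀ => ⟨fderivWithin ℝ G S z₀, ?_⟩⟩
  intro z hz z' hz' r hr hr'
  -- The derivative of `G` differs from its value at `z₀` by at most `K * r` on the part of the
  -- convex set within distance `r` of `z₀`.
  refine Convex.norm_image_sub_le_of_norm_hasFDerivWithin_le' (s := T ∩ Metric.closedBall z₀ r)
    (f' := fderivWithin ℝ G S) ?_ ?_ (hTconv.inter (convex_closedBall _ _)) ?_ ?_
  · intro x hx
    exact ((h1.1 x (hTS hx.1)).hasFDerivWithinAt).mono (inter_subset_left.trans hTS)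
  · intro x hx
    have := hTconv.norm_image_sub_le_of_norm_hasFDerivWithin_le (f := fderivWithin ℝ G S)
      (f' := fderivWithin ℝ (fderivWithin ℝ G S) S) (C := max K 0)
      (fun x hx => (h2.1 x (hTS hx)).hasFDerivWithinAt.mono hTS)
      (fun x hx => (hK x hx).trans (le_max_left _ _)) hz₀ hx.1
    refine this.trans (mul_le_mul_of_nonneg_left ?_ (le_max_right _ _))
    simpa [dist_eq_norm] using hx.2
  · exact ⟨hz, by simpa [dist_eq_norm] using hr⟩
  · exact ⟨hz', by simpa [dist_eq_norm] using hr'⟩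

/-- The expansion of the defect of a quadrature formula with nodes `τ` and coefficients `α`. -/
theorem norm_quadrature_defect_le {a b : ℝ} {u v : ℝ → E} {m : ℕ} {c : ℝ → ℕ → E} {B : ℝ}
    (hB : 0 ≤ B) (hu : ∀ t ∈ Icc a b, HasDerivWithinAt u (v t) (Icc a b) t)
    (hv : ∀ t ∈ Icc a b, ∀ s, 0 ≤ s → t + s ∈ Icc a b →
      ‖v (t + s) - ∑ k ∈ Finset.range m, s ^ k • c t k‖ ≤ B * s ^ m)
    {ι : Type*} [Fintype ι] {τ : ι → ℝ} (hτ : ∀ i, τ i ∈ Icc (0 : ℝ) 1) (α : ι → ℝ) {θ : ℝ}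
    (hθ : θ ∈ Icc (0 : ℝ) 1) {t h : ℝ} (ht : t ∈ Icc a b) (hh : 0 ≤ h) (hth : t + h ∈ Icc a b) :
    ‖u (t + θ * h) - u t - h • ∑ i, α i • v (t + τ i * h) -
        ∑ k ∈ Finset.range m, (h ^ (k + 1) * (θ ^ (k + 1) / (k + 1) - ∑ i, α i * τ i ^ k)) • c t k‖
      ≤ (1 + ∑ i, |α i|) * B * h ^ (m + 1) := by
  have hle : ∀ x ∈ Icc (0 : ℝ) 1, 0 ≤ x * h ∧ x * h ≤ h := fun x hx =>
    ⟨mul_nonneg hx.1 hh, mul_le_of_le_one_left hh hx.2⟩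
  have h1 : ‖u (t + θ * h) - u t - ∑ k ∈ Finset.range m, ((θ * h) ^ (k + 1) / (k + 1)) • c t k‖
      ≤ B * h ^ (m + 1) :=
    (norm_sub_sum_le_of_expansion hB hu hv ht (hle θ hθ).1 (add_mul_mem_Icc ht hh hth hθ)).trans
      (mul_le_mul_of_nonneg_left (pow_le_pow_left₀ (hle θ hθ).1 (hle θ hθ).2 _) hB)
  have h2 : ‖∑ i, α i • (v (t + τ i * h) - ∑ k ∈ Finset.range m, (τ i * h) ^ k • c t k)‖
      ≤ (∑ i, |α i|) * (B * h ^ m) := by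
    refine norm_sum_smul_le _ _ fun i => ?_
    exact (hv t ht _ (hle _ (hτ i)).1 (add_mul_mem_Icc ht hh hth (hτ i))).trans
      (mul_le_mul_of_nonneg_left (pow_le_pow_left₀ (hle _ (hτ i)).1 (hle _ (hτ i)).2 _) hB)
  -- Exchanging the sums exposes the classical order conditions as the coefficients of the powers of
  -- `h`.
  have hsum : ∑ k ∈ Finset.range m, (h ^ (k + 1) * (θ ^ (k + 1) / (k + 1) - ∑ i, α i * τ i ^ k)) •
      c t k = ∑ k ∈ Finset.range m, ((θ * h) ^ (k + 1) / (k + 1)) • c t k -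
        h • ∑ i, α i • ∑ k ∈ Finset.range m, (τ i * h) ^ k • c t k := by
    simp only [Finset.smul_sum]
    rw [Finset.sum_comm, ← Finset.sum_sub_distrib]
    refine Finset.sum_congr rfl fun k _ => ?_
    simp only [smul_smul]
    rw [← Finset.sum_smul, ← sub_smul]
    congr 1
    rw [mul_sub, Finset.mul_sum]
    congr 1
    · ring
    · exact Finset.sum_congr rfl fun i _ => by ring
  calc _ = ‖(u (t + θ * h) - u t - ∑ k ∈ Finset.range m, ((θ * h) ^ (k + 1) / (k + 1)) • c t k) -
        h • ∑ i, α i • (v (t + τ i * h) - ∑ k ∈ Finset.range m, (τ i * h) ^ k • c t k)‖ := by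
        rw [hsum]
        simp only [smul_sub, Finset.sum_sub_distrib]
        congr 1
        abel
    _ ≤ B * h ^ (m + 1) + h * ((∑ i, |α i|) * (B * h ^ m)) := by
        refine (norm_sub_le _ _).trans (add_le_add h1 ?_)
        rw [norm_smul, Real.norm_eq_abs, abs_of_nonneg hh]
        exact mul_le_mul_of_nonneg_left h2 hh
    _ = _ := by ring

/-- The defect of an interpolation formula that is exact for polynomials of degree less than `m`. -/
theorem norm_interpolation_defect_le {a b : ℝ} {v : ℝ → E} {m : ℕ} {c : ℝ → ℕ → E} {B : ℝ}
    (hB : 0 ≤ B)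
    (hv : ∀ t ∈ Icc a b, ∀ s, 0 ≤ s → t + s ∈ Icc a b →
      ‖v (t + s) - ∑ k ∈ Finset.range m, s ^ k • c t k‖ ≤ B * s ^ m)
    {ι : Type*} [Fintype ι] {τ : ι → ℝ} (hτ : ∀ i, τ i ∈ Icc (0 : ℝ) 1) (α : ι → ℝ) {θ : ℝ}
    (hθ : θ ∈ Icc (0 : ℝ) 1) (hα : ∀ k < m, ∑ i, α i * τ i ^ k = θ ^ k)
    {t h : ℝ} (ht : t ∈ Icc a b) (hh : 0 ≤ h) (hth : t + h ∈ Icc a b) :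
    ‖∑ i, α i • v (t + τ i * h) - v (t + θ * h)‖ ≤ (1 + ∑ i, |α i|) * B * h ^ m := by
  have hle : ∀ x ∈ Icc (0 : ℝ) 1, 0 ≤ x * h ∧ x * h ≤ h := fun x hx =>
    ⟨mul_nonneg hx.1 hh, mul_le_of_le_one_left hh hx.2⟩
  have hrem : ∀ x ∈ Icc (0 : ℝ) 1,
      ‖v (t + x * h) - ∑ k ∈ Finset.range m, (x * h) ^ k • c t k‖ ≤ B * h ^ m := fun x hx =>
    (hv t ht _ (hle x hx).1 (add_mul_mem_Icc ht hh hth hx)).trans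
      (mul_le_mul_of_nonneg_left (pow_le_pow_left₀ (hle x hx).1 (hle x hx).2 _) hB)
  have h2 : ‖∑ i, α i • (v (t + τ i * h) - ∑ k ∈ Finset.range m, (τ i * h) ^ k • c t k)‖
      ≤ (∑ i, |α i|) * (B * h ^ m) := norm_sum_smul_le _ _ fun i => hrem _ (hτ i)
  have hsum : ∑ i, α i • ∑ k ∈ Finset.range m, (τ i * h) ^ k • c t k =
      ∑ k ∈ Finset.range m, (θ * h) ^ k • c t k := by
    simp only [Finset.smul_sum]
    rw [Finset.sum_comm]
    refine Finset.sum_congr rfl fun k hk => ?_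
    simp only [smul_smul]
    rw [← Finset.sum_smul, mul_pow, ← hα k (Finset.mem_range.1 hk), Finset.sum_mul]
    simp only [mul_pow, mul_assoc]
  calc _ = ‖∑ i, α i • (v (t + τ i * h) - ∑ k ∈ Finset.range m, (τ i * h) ^ k • c t k) -
        (v (t + θ * h) - ∑ k ∈ Finset.range m, (θ * h) ^ k • c t k)‖ := by
        simp only [smul_sub, Finset.sum_sub_distrib, hsum]
        congr 1
        abel
    _ ≤ (∑ i, |α i|) * (B * h ^ m) + B * h ^ m :=
        (norm_sub_le _ _).trans (add_le_add h2 (hrem θ hθ))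
    _ = _ := by ring

end Analysis

end

/-! ### Order conditions of the scheme and defects of the exact solution. -/

section

/-- The coefficient of the leading term of the stage defects. -/
def stageDefect (N : ℕ) (p : Fin (N + 1)) : ℝ :=
  node N p ^ (N + 1) / (N + 1) - ∑ q, matA N p q * node N q ^ N

theorem sum_matA_mul_node_pow {N k : ℕ} (hk : k < N) (p : Fin (N + 1)) :
    ∑ q, matA N p q * node N q ^ k = node N p ^ (k + 1) / (k + 1) := by
  have h := sum_matA_mul (P := X ^ (k + 1)) (N := N)
    ((degree_X_pow _).le.trans (by exact_mod_cast hk)) p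
  simp only [derivative_X_pow, eval_mul, eval_pow, eval_X, eval_C, Nat.add_sub_cancel,
    ne_eq, Nat.add_eq_zero_iff, one_ne_zero, and_false, not_false_eq_true, zero_pow, sub_zero] at h
  rw [← h, Finset.sum_div]
  refine Finset.sum_congr rfl fun q _ => ?_
  push_cast
  field_simp

theorem sum_weight_mul_node_pow {N k : ℕ} (hk : k ≤ 2 * N + 1) :
    ∑ p, weight N p * node N p ^ k = 1 / (k + 1) := by
  have h := sum_weight_mul_of_degree_le (N := N) (P := X ^ k) (by rwa [natDegree_X_pow])
  simpa using h

/-- Both parts equal `1 / ((N + 1) (N + 2))`: one is the Gauss quadrature of `τ ^ (N + 1)` divided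
by `N + 1`, the other is `∫ (1 - τ) τ ^ N`. This cancellation yields the additional order. -/
theorem sum_weight_mul_stageDefect {N : ℕ} (hN : 1 ≤ N) :
    ∑ p, weight N p * stageDefect N p = 0 := by
  have h1 := sum_weight_mul_node_pow (N := N) (k := N + 1) (by omega)
  have h2 := sum_weight_mul_sum_matA hN (P := X ^ N) (degree_X_pow _).le
  simp only [eval_pow, eval_X, eval_mul, eval_sub, sub_mul, one_mul] at h2
  have h3 : ∫ x in (0 : ℝ)..1, (x ^ N - x * x ^ N) = 1 / (N + 1) - 1 / (N + 2) := by
    simp only [← pow_succ']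
    rw [intervalIntegral.integral_sub ((continuous_pow _).intervalIntegrable _ _)
      ((continuous_pow _).intervalIntegrable _ _), integral_pow, integral_pow]
    simp
    ring
  simp only [stageDefect, mul_sub, Finset.sum_sub_distrib, h2, h3, ← mul_div_assoc,
    ← Finset.sum_div, h1]
  push_cast
  have : (N : ℝ) + 1 ≠ 0 := by positivity
  have : (N : ℝ) + 2 ≠ 0 := by positivity
  have : (N : ℝ) + 1 + 1 ≠ 0 := by positivity
  field_simp
  ring

theorem sum_phi_mul_node_pow {N k : ℕ} (hk : k < N + 1) (τ : ℝ) :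
    ∑ p, (phi N p).eval τ * node N p ^ k = τ ^ k := by
  have h := sum_eval_phi_mul (P := X ^ k) (N := N)
    ((degree_X_pow _).le.trans (by exact_mod_cast Nat.le_of_lt_succ hk)) τ
  simpa using h

theorem sum_integral_phi_mul_node_pow {N k : ℕ} (hk : k < N + 1) (τ : ℝ) :
    ∑ p, (∫ ξ in (0 : ℝ)..τ, (phi N p).eval ξ) * node N p ^ k = τ ^ (k + 1) / (k + 1) := by
  simp only [← intervalIntegral.integral_mul_const]
  rw [← intervalIntegral.integral_finsetSum fun p _ =>
    ((phi N p).continuous.fun_mul continuous_const).intervalIntegrable _ _]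
  simp [sum_phi_mul_node_pow hk]

theorem exists_sum_abs_phi_le (N : ℕ) :
    ∃ Λ, 0 ≤ Λ ∧ (∀ τ ∈ Icc (0 : ℝ) 1, ∑ p, |(phi N p).eval τ| ≤ Λ) ∧
      ∀ τ ∈ Icc (0 : ℝ) 1, ∑ p, |∫ ξ in (0 : ℝ)..τ, (phi N p).eval ξ| ≤ Λ := by
  have h : ∀ p, ∃ B, ∀ τ ∈ Icc (0 : ℝ) 1, |(phi N p).eval τ| ≤ B := fun p =>
    isCompact_Icc.exists_bound_of_continuousOn (phi N p).continuousOn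
  choose B hB using h
  have hB0 : ∀ p, 0 ≤ B p := fun p => (abs_nonneg _).trans (hB p 0 (by simp))
  refine ⟨∑ p, B p, Finset.sum_nonneg fun p _ => hB0 p,
    fun τ hτ => Finset.sum_le_sum fun p _ => hB p τ hτ,
    fun τ hτ => Finset.sum_le_sum fun p _ => ?_⟩
  have := intervalIntegral.norm_integral_le_of_norm_le_const (a := 0) (b := τ)
    (f := fun ξ => (phi N p).eval ξ) (C := B p) (fun ξ hξ => by
      rw [uIoc_of_le hτ.1] at hξ
      exact hB p ξ ⟨hξ.1.le, hξ.2.trans hτ.2⟩)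
  rw [sub_zero, abs_of_nonneg hτ.1] at this
  exact this.trans (mul_le_of_le_one_right (hB0 p) hτ.2)

theorem node_mem_Icc (N : ℕ) (p : Fin (N + 1)) : node N p ∈ Icc (0 : ℝ) 1 :=
  Ioo_subset_Icc_self (node_mem_Ioo N p)

variable {E : Type*} [NormedAddCommGroup E] [NormedSpace ℝ E]

/-- The exact solution satisfies the predictor equations up to `h ^ (N + 1)`, with a known leading
term, and the update equation up to `h ^ (N + 3)`. -/
theorem exists_defect_bound {N : ℕ} (hN : 1 ≤ N) {a b : ℝ} (hab : a < b) {u v : ℝ → E}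
    (hu : ∀ t ∈ Icc a b, HasDerivWithinAt u (v t) (Icc a b) t)
    (hv : ContDiffOn ℝ ((N + 2 : ℕ) : WithTop ℕ∞) v (Icc a b)) :
    ∃ c : ℝ → E, ∃ K, 0 ≤ K ∧ (∀ t ∈ Icc a b, ‖c t‖ ≤ K) ∧
      ∀ t h, t ∈ Icc a b → 0 ≤ h → h ≤ 1 → t + h ∈ Icc a b →
        (∀ p, ‖u (t + node N p * h) - u t - h • ∑ q, matA N p q • v (t + node N q * h) -
          (h ^ (N + 1) * stageDefect N p) • c t‖ ≤ K * h ^ (N + 2)) ∧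
        ‖u (t + h) - u t - h • ∑ p, weight N p • v (t + node N p * h)‖ ≤ K * h ^ (N + 3) := by
  obtain ⟨c, B, hB, hc, hexp⟩ := exists_uniform_expansion hab (N + 2) hv
  -- These are the stage coefficients of `h ^ (N + 2)`, one order beyond `stageDefect`; they only
  -- need to be bounded.
  set κ : Fin (N + 1) → ℝ := fun p =>
    node N p ^ (N + 1 + 1) / ((N + 1 : ℕ) + 1) - ∑ q, matA N p q * node N q ^ (N + 1) with hκ
  set S := ∑ p, |κ p| + ∑ p, ∑ q, |matA N p q| + ∑ p, |weight N p| + 1 with hS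
  have hκ0 : ∀ p, |κ p| ≤ ∑ p, |κ p| := fun p =>
    Finset.single_le_sum (f := fun p => |κ p|) (fun _ _ => abs_nonneg _) (Finset.mem_univ p)
  have hA0 : ∀ p, ∑ q, |matA N p q| ≤ ∑ p, ∑ q, |matA N p q| := fun p =>
    Finset.single_le_sum (f := fun p => ∑ q, |matA N p q|)
      (fun _ _ => Finset.sum_nonneg fun _ _ => abs_nonneg _) (Finset.mem_univ p)
  have hκs : 0 ≤ ∑ p, |κ p| := Finset.sum_nonneg fun _ _ => abs_nonneg _
  have hAs : 0 ≤ ∑ p, ∑ q, |matA N p q| :=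
    Finset.sum_nonneg fun _ _ => Finset.sum_nonneg fun _ _ => abs_nonneg _
  have hws : 0 ≤ ∑ p, |weight N p| := Finset.sum_nonneg fun _ _ => abs_nonneg _
  have hS1 : 1 ≤ S := by rw [hS]; linarith
  refine ⟨fun t => c t N, S * B, by positivity,
    fun t ht => (hc t ht N).trans (le_mul_of_one_le_left hB hS1), ?_⟩
  intro t h ht hh h1 hth
  constructor
  · intro p
    have hd := norm_quadrature_defect_le hB hu hexp (node_mem_Icc N) (matA N p)
      (node_mem_Icc N p) ht hh hth
    -- The terms `k < N` vanish by exactness of `A`, `k = N` is the leading term kept in the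
    -- statement, and `k = N + 1` goes into the remainder.
    rw [Finset.sum_range_succ, Finset.sum_range_succ, Finset.sum_eq_zero (s := Finset.range N),
      zero_add] at hd
    · have htri : ∀ x y z : E, ‖x - y‖ ≤ ‖x - (y + z)‖ + ‖z‖ := fun x y z =>
        calc ‖x - y‖ = ‖x - (y + z) + z‖ := by congr 1; abel
          _ ≤ _ := norm_add_le _ _
      refine (htri _ _ _).trans ((add_le_add hd le_rfl).trans ?_)
      rw [norm_smul, norm_mul, norm_pow, Real.norm_eq_abs, Real.norm_eq_abs, abs_of_nonneg hh]
      have e1 : (1 + ∑ q, |matA N p q|) * B * h ^ (N + 2 + 1) ≤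
          (1 + ∑ p, ∑ q, |matA N p q|) * B * h ^ (N + 2) := by
        refine mul_le_mul (mul_le_mul_of_nonneg_right (by linarith [hA0 p]) hB)
          (pow_le_pow_of_le_one hh h1 (by omega)) (by positivity) (by positivity)
      have e2 : h ^ (N + 1 + 1) * |κ p| * ‖c t (N + 1)‖ ≤
          h ^ (N + 2) * (∑ p, |κ p|) * B :=
        mul_le_mul (mul_le_mul_of_nonneg_left (hκ0 p) (by positivity)) (hc t ht _)
          (norm_nonneg _) (by positivity)
      have e3 : 0 ≤ (∑ p, |weight N p|) * B * h ^ (N + 2) := by positivity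
      rw [hS]
      nlinarith [e1, e2, e3]
    · intro k hk
      rw [sum_matA_mul_node_pow (Finset.mem_range.1 hk), sub_self, mul_zero, zero_smul]
  · have hd := norm_quadrature_defect_le hB hu hexp (node_mem_Icc N) (weight N)
      (right_mem_Icc.2 zero_le_one) ht hh hth
    rw [Finset.sum_eq_zero (s := Finset.range _), sub_zero, one_mul] at hd
    · refine hd.trans (mul_le_mul_of_nonneg_right (mul_le_mul_of_nonneg_right ?_ hB)
        (by positivity))
      rw [hS]
      linarith
    · intro k hk
      have := Finset.mem_range.1 hk
      rw [sum_weight_mul_node_pow (by omega), one_pow, sub_self, mul_zero, zero_smul]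

/-- The exact solution satisfies the equation of the improved local solution up to `h ^ (N + 2)`,
and its interpolant on the nodes is accurate up to `h ^ (N + 1)`. -/
theorem exists_dense_defect_bound {N : ℕ} {a b : ℝ} (hab : a < b) {u v : ℝ → E}
    (hu : ∀ t ∈ Icc a b, HasDerivWithinAt u (v t) (Icc a b) t)
    (hu' : ContDiffOn ℝ ((N + 1 : ℕ) : WithTop ℕ∞) u (Icc a b))
    (hv : ContDiffOn ℝ ((N + 1 : ℕ) : WithTop ℕ∞) v (Icc a b)) :
    ∃ K, 0 ≤ K ∧ ∀ t h, t ∈ Icc a b → 0 ≤ h → t + h ∈ Icc a b → ∀ τ ∈ Icc (0 : ℝ) 1,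
      ‖u (t + τ * h) - u t - h • ∑ p, (∫ ξ in (0 : ℝ)..τ, (phi N p).eval ξ) •
        v (t + node N p * h)‖ ≤ K * h ^ (N + 2) ∧
      ‖∑ p, (phi N p).eval τ • u (t + node N p * h) - u (t + τ * h)‖ ≤ K * h ^ (N + 1) := by
  obtain ⟨c, B, hB, -, hexp⟩ := exists_uniform_expansion hab (N + 1) hv
  obtain ⟨c', B', hB', -, hexp'⟩ := exists_uniform_expansion hab (N + 1) hu'
  obtain ⟨Λ, hΛ, h1, h2⟩ := exists_sum_abs_phi_le N
  refine ⟨(1 + Λ) * max B B', by positivity, fun t h ht hh hth τ hτ => ⟨?_, ?_⟩⟩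
  · have hd := norm_quadrature_defect_le hB hu hexp (node_mem_Icc N)
      (fun p => ∫ ξ in (0 : ℝ)..τ, (phi N p).eval ξ) hτ ht hh hth
    rw [Finset.sum_eq_zero (s := Finset.range _), sub_zero] at hd
    · refine hd.trans (mul_le_mul_of_nonneg_right (mul_le_mul ?_ (le_max_left _ _) hB
        (by positivity)) (by positivity))
      linarith [h2 τ hτ]
    · intro k hk
      rw [sum_integral_phi_mul_node_pow (Finset.mem_range.1 hk), sub_self, mul_zero, zero_smul]
  · have hd := norm_interpolation_defect_le hB' hexp' (node_mem_Icc N)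
      (fun p => (phi N p).eval τ) hτ (fun k hk => sum_phi_mul_node_pow hk τ) ht hh hth
    refine hd.trans (mul_le_mul_of_nonneg_right (mul_le_mul ?_ (le_max_right _ _) hB'
      (by positivity)) (by positivity))
    linarith [h1 τ hτ]

end

/-! ### Solvability and stability of the stages, and the error of one step. -/

section

section Stages

variable {E : Type*} [NormedAddCommGroup E] [NormedSpace ℝ E] {ι : Type*} [Fintype ι]

theorem sum_abs_row_le (A : ι → ι → ℝ) (p : ι) : ∑ q, |A p q| ≤ ∑ p, ∑ q, |A p q| :=
  Finset.single_le_sum (f := fun p => ∑ q, |A p q|)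
    (fun _ _ => Finset.sum_nonneg fun _ _ => abs_nonneg _) (Finset.mem_univ p)

/-- The implicit stage equations are solvable for small steps. -/
theorem exists_stages [CompleteSpace E] (A : ι → ι → ℝ) {f : ι → E → E} {L h : ℝ} (hL : 0 ≤ L)
    (hh : 0 ≤ h) (hf : ∀ q x y, ‖f q x - f q y‖ ≤ L * ‖x - y‖)
    (hsmall : h * (∑ p, ∑ q, |A p q|) * L ≤ 1 / 2) (y : E) :
    ∃ Q : ι → E, ∀ p, Q p - h • ∑ q, A p q • f q (Q q) = y := by
  set T : (ι → E) → ι → E := fun Q p => y + h • ∑ q, A p q • f q (Q q) with hT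
  -- The step restriction `hsmall` makes the stage map a contraction in the maximum norm over the
  -- stages.
  have hc : ContractingWith (1 / 2) T := by
    refine ⟨by norm_num, LipschitzWith.of_dist_le_mul fun Q Q' => ?_⟩
    rw [dist_eq_norm, dist_eq_norm, pi_norm_le_iff_of_nonneg (by positivity)]
    intro p
    have h1 : T Q p - T Q' p = h • ∑ q, A p q • (f q (Q q) - f q (Q' q)) := by
      simp only [hT, smul_sub, Finset.sum_sub_distrib]
      abel
    rw [Pi.sub_apply, h1, norm_smul, Real.norm_eq_abs, abs_of_nonneg hh]
    have h2 := norm_sum_smul_le (A p) (fun q => f q (Q q) - f q (Q' q))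
      (X := L * ‖Q - Q'‖) fun q => (hf q _ _).trans
        (mul_le_mul_of_nonneg_left (norm_le_pi_norm (Q - Q') q) hL)
    calc _ ≤ h * ((∑ p, ∑ q, |A p q|) * (L * ‖Q - Q'‖)) := mul_le_mul_of_nonneg_left
          (h2.trans (mul_le_mul_of_nonneg_right (sum_abs_row_le A p) (by positivity))) hh
      _ = h * (∑ p, ∑ q, |A p q|) * L * ‖Q - Q'‖ := by ring
      _ ≤ 1 / 2 * ‖Q - Q'‖ := mul_le_mul_of_nonneg_right hsmall (norm_nonneg _)
      _ = _ := by simp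
  refine ⟨hc.fixedPoint, fun p => ?_⟩
  have := congrFun hc.fixedPoint_isFixedPt.eq p
  exact sub_eq_iff_eq_add.2 this.symm

/-- Stability of the stage equations under a perturbation with leading part `s`. -/
theorem stage_error_le (A : ι → ι → ℝ) {L h ρ σ : ℝ} (hL : 0 ≤ L) (hh : 0 ≤ h)
    (hρ : 0 ≤ ρ) (hσ : 0 ≤ σ)
    {Q x f v s : ι → E} {y y₀ : E} (hQ : ∀ p, Q p - h • ∑ q, A p q • f q = y)
    (hf : ∀ q, ‖f q - v q‖ ≤ L * ‖Q q - x q‖)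
    (hd : ∀ p, ‖x p - y₀ - h • ∑ q, A p q • v q - s p‖ ≤ ρ) (hs : ∀ p, ‖s p‖ ≤ σ)
    (hsmall : h * (∑ p, ∑ q, |A p q|) * L ≤ 1 / 2) :
    (∀ p, ‖Q p - x p‖ ≤ 2 * (‖y - y₀‖ + ρ + σ)) ∧
      ∀ p, ‖Q p - (x p - s p)‖ ≤
        ‖y - y₀‖ + h * (∑ p, ∑ q, |A p q|) * L * (2 * (‖y - y₀‖ + ρ + σ)) + ρ := by
  set α := ∑ p, ∑ q, |A p q| with hα
  have hα0 : 0 ≤ α := Finset.sum_nonneg fun _ _ => Finset.sum_nonneg fun _ _ => abs_nonneg _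
  set ε : ι → E := Q - x with hε
  have hr : ∀ p, ‖Q p - (x p - s p)‖ ≤ ‖y - y₀‖ + h * α * L * ‖ε‖ + ρ := by
    intro p
    have h1 : Q p - (x p - s p) = (y - y₀) + h • ∑ q, A p q • (f q - v q) -
        (x p - y₀ - h • ∑ q, A p q • v q - s p) := by
      rw [← hQ p]
      simp only [smul_sub, Finset.sum_sub_distrib]
      abel
    have h2 := norm_sum_smul_le (A p) (fun q => f q - v q) (X := L * ‖ε‖) fun q =>
      (hf q).trans (mul_le_mul_of_nonneg_left (norm_le_pi_norm ε q) hL)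
    rw [h1]
    refine (norm_sub_le _ _).trans (add_le_add ((norm_add_le _ _).trans
      (add_le_add le_rfl ?_)) (hd p))
    rw [norm_smul, Real.norm_eq_abs, abs_of_nonneg hh]
    calc _ ≤ h * (α * (L * ‖ε‖)) := mul_le_mul_of_nonneg_left
          (h2.trans (mul_le_mul_of_nonneg_right (sum_abs_row_le A p) (by positivity))) hh
      _ = _ := by ring
  -- By `hsmall` half of `‖ε‖` is absorbed on the left, hence the factor 2. Inserting this bound
  -- into `hr` gives the sharper second estimate, where `σ` appears only with a factor `h`.
  have hm : ‖ε‖ ≤ 2 * (‖y - y₀‖ + ρ + σ) := by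
    have : ‖ε‖ ≤ ‖y - y₀‖ + h * α * L * ‖ε‖ + ρ + σ := by
      refine (pi_norm_le_iff_of_nonneg (by positivity)).2 fun p => ?_
      calc ‖ε p‖ = ‖(Q p - (x p - s p)) - s p‖ := by
            congr 1
            simp only [hε, Pi.sub_apply]
            abel
        _ ≤ _ := (norm_sub_le _ _).trans (add_le_add (hr p) (hs p))
    have := mul_le_mul_of_nonneg_right hsmall (norm_nonneg ε)
    linarith
  exact ⟨fun p => (norm_le_pi_norm ε p).trans hm, fun p => (hr p).trans (by gcongr)⟩

end Stages

variable {E : Type*} [NormedAddCommGroup E] [NormedSpace ℝ E]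

/-- Linearization of the right-hand side around the exact solution, on one step. -/
theorem exists_linearization_bound [ProperSpace E] {a b : ℝ} (hab : a < b) {F : E → ℝ → E}
    (hF : ContDiffOn ℝ 2 (fun z : E × ℝ => F z.1 z.2) (univ ×ˢ Icc a b))
    {u : ℝ → E} (hu : ∀ t ∈ Icc a b, HasDerivWithinAt u (F (u t) t) (Icc a b) t)
    {G : ℝ} (hG0 : 0 ≤ G) :
    ∃ K, 0 ≤ K ∧ ∀ t h, t ∈ Icc a b → 0 ≤ h → h ≤ 1 → t + h ∈ Icc a b →
      ∃ J : E →L[ℝ] E, ∀ θ ∈ Icc (0 : ℝ) 1, ∀ s : E, ‖s‖ ≤ h * G →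
        ‖F (u (t + θ * h) - s) (t + θ * h) - F (u (t + θ * h)) (t + θ * h) + J s‖
          ≤ K * h * ‖s‖ := by
  have huC : ContinuousOn u (Icc a b) := fun t ht => (hu t ht).continuousWithinAt
  obtain ⟨Um, hUm⟩ := isCompact_Icc.exists_bound_of_continuousOn huC
  obtain ⟨V, hV⟩ := isCompact_Icc.exists_bound_of_continuousOn
    (hF.continuousOn.comp (huC.prodMk continuousOn_id) fun t ht => ⟨mem_univ _, ht⟩)
  have hV0 : 0 ≤ V := (norm_nonneg _).trans (hV a (left_mem_Icc.2 hab.le))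
  obtain ⟨K, hK, hsec⟩ := exists_second_order_bound hab hF (Um + G)
  refine ⟨K * (V + G + 1), by positivity, fun t h ht hh h1 hth => ?_⟩
  -- The derivative is frozen at the left end of the step, so that a single `J` serves all stages
  -- and can be taken out of the weighted sum. Below, only its part in the state variable is kept.
  obtain ⟨J, hJ⟩ := hsec (u t, t) ⟨by
    rw [mem_closedBall_zero_iff]; linarith [hUm t ht], ht⟩
  refine ⟨J.comp (ContinuousLinearMap.inl ℝ E ℝ), fun θ hθ s hsG => ?_⟩
  have htp := add_mul_mem_Icc ht hh hth hθ
  have hsG' : ‖s‖ ≤ G := hsG.trans (mul_le_of_le_one_left hG0 h1)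
  have htd : ‖t + θ * h - t‖ ≤ h := by
    rw [add_sub_cancel_left, Real.norm_eq_abs, abs_of_nonneg (mul_nonneg hθ.1 hh)]
    exact mul_le_of_le_one_left hh hθ.2
  have hud : ‖u (t + θ * h) - u t‖ ≤ V * h :=
    ((convex_Icc a b).norm_image_sub_le_of_norm_hasDerivWithin_le hu hV ht htp).trans
      (mul_le_mul_of_nonneg_left htd hV0)
  have hVh : 0 ≤ V * h := by positivity
  have hGh : 0 ≤ h * G := by positivity
  have hr : h * (V + G + 1) = V * h + h * G + h := by ring
  have hsec' := hJ (u (t + θ * h), t + θ * h)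
    ⟨by rw [mem_closedBall_zero_iff]; linarith [hUm _ htp], htp⟩
    (u (t + θ * h) - s, t + θ * h)
    ⟨by rw [mem_closedBall_zero_iff]
        exact (norm_sub_le _ _).trans (add_le_add (hUm _ htp) hsG'), htp⟩
    -- The radius covers the motion of `u` (at most `V * h`), the perturbation `s` (at most `h * G`)
    -- and the shift in time (at most `h`).
    (h * (V + G + 1)) ?_ ?_
  · have hdiff : ((u (t + θ * h) - s, t + θ * h) : E × ℝ) - (u (t + θ * h), t + θ * h) =
        -(s, 0) := by
      ext <;> simp
    rw [hdiff, norm_neg, map_neg, sub_neg_eq_add, Prod.norm_mk, norm_zero,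
      max_eq_left (norm_nonneg s)] at hsec'
    refine hsec'.trans_eq ?_
    ring
  · rw [Prod.mk_sub_mk, Prod.norm_mk]
    exact max_le (by linarith) (by linarith)
  · rw [Prod.mk_sub_mk, Prod.norm_mk]
    refine max_le ?_ (by linarith)
    calc _ = ‖(u (t + θ * h) - u t) - s‖ := by congr 1; abel
      _ ≤ V * h + h * G := (norm_sub_le _ _).trans (add_le_add hud hsG)
      _ ≤ _ := by linarith

/-- Error of the predictor and error propagation of the update in one step. -/
theorem exists_step_bound [ProperSpace E] {N : ℕ} (hN : 1 ≤ N) {a b : ℝ} (hab : a < b)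
    {F : E → ℝ → E} {L : ℝ} (hL : 0 ≤ L)
    (hF : ContDiffOn ℝ ((N + 2 : ℕ) : WithTop ℕ∞) (fun z : E × ℝ => F z.1 z.2) (univ ×ˢ Icc a b))
    (hLip : ∀ t ∈ Icc a b, ∀ x y : E, ‖F x t - F y t‖ ≤ L * ‖x - y‖)
    {u : ℝ → E} (hu : ∀ t ∈ Icc a b, HasDerivWithinAt u (F (u t) t) (Icc a b) t) :
    ∃ K, 0 ≤ K ∧ ∀ t h, t ∈ Icc a b → 0 ≤ h → h ≤ 1 → t + h ∈ Icc a b →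
      h * (∑ p, ∑ q, |matA N p q|) * L ≤ 1 / 2 →
      ∀ (y : E) (Q : Fin (N + 1) → E),
        (∀ p, Q p - h • ∑ q, matA N p q • F (Q q) (t + node N q * h) = y) →
        (∀ p, ‖Q p - u (t + node N p * h)‖ ≤ K * (‖y - u t‖ + h ^ (N + 1))) ∧
        ‖y + h • ∑ p, weight N p • F (Q p) (t + node N p * h) - u (t + h)‖ ≤
          ‖y - u t‖ + K * h * (‖y - u t‖ + h ^ (N + 2)) := by
  have huC := contDiffOn_solution hab hF hu
  have hvC : ContDiffOn ℝ ((N + 2 : ℕ) : WithTop ℕ∞) (fun t => F (u t) t) (Icc a b) :=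
    hF.comp ((huC.of_le (by exact_mod_cast Nat.le_succ _)).prodMk contDiffOn_id)
      fun t ht => ⟨mem_univ _, ht⟩
  obtain ⟨c, K₀, hK₀, hc, hdef⟩ := exists_defect_bound hN hab hu hvC
  set Γ := ∑ p, |stageDefect N p| with hΓ
  have hΓ0 : 0 ≤ Γ := Finset.sum_nonneg fun _ _ => abs_nonneg _
  have hΓp : ∀ p, |stageDefect N p| ≤ Γ := fun p =>
    Finset.single_le_sum (f := fun p => |stageDefect N p|) (fun _ _ => abs_nonneg _)
      (Finset.mem_univ p)
  set G := Γ * K₀ with hG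
  have hG0 : 0 ≤ G := mul_nonneg hΓ0 hK₀
  obtain ⟨K₂, hK₂, hlin⟩ := exists_linearization_bound hab
    (hF.of_le (by exact_mod_cast Nat.le_add_left 2 N)) hu hG0
  set α := ∑ p, ∑ q, |matA N p q| with hα
  have hα0 : 0 ≤ α := Finset.sum_nonneg fun _ _ => Finset.sum_nonneg fun _ _ => abs_nonneg _
  set ω := ∑ p, |weight N p| with hω
  have hω0 : 0 ≤ ω := Finset.sum_nonneg fun _ _ => abs_nonneg _
  -- `C₁` bounds the stage error after removal of the leading part `s`: in the feedback through `F`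
  -- the size `h ^ (N + 1)` of `s` gains a factor `h`. `C₂` belongs to the linearization error.
  set C₁ := 1 + 2 * α * L * (1 + K₀ + G) + K₀ with hC₁
  set C₂ := K₂ * G with hC₂
  have hC₁0 : 0 ≤ C₁ := by positivity
  have hC₂0 : 0 ≤ C₂ := by positivity
  clear_value Γ G α ω C₁ C₂
  refine ⟨2 * (1 + K₀ + G) + ω * (L * C₁ + C₂) + K₀, by positivity, ?_⟩
  intro t h ht hh h1 hth hsmall y Q hQ
  obtain ⟨hst, hup⟩ := hdef t h ht hh h1 hth
  have htp : ∀ p, t + node N p * h ∈ Icc a b := fun p =>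
    add_mul_mem_Icc ht hh hth (node_mem_Icc N p)
  set e := ‖y - u t‖ with he
  have he0 : 0 ≤ e := norm_nonneg _
  set s : Fin (N + 1) → E := fun p => (h ^ (N + 1) * stageDefect N p) • c t with hs
  have hsn : ∀ p, ‖s p‖ ≤ h ^ (N + 1) * G := fun p => by
    rw [hs, norm_smul, norm_mul, norm_pow, Real.norm_eq_abs, Real.norm_eq_abs, abs_of_nonneg hh,
      hG, ← mul_assoc]
    exact mul_le_mul (mul_le_mul_of_nonneg_left (hΓp p) (by positivity)) (hc t ht)
      (norm_nonneg _) (by positivity)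
  have hp1 : h ^ (N + 1) ≤ h := pow_le_of_le_one hh h1 (by omega)
  have hp2 : h ^ (N + 2) ≤ h ^ (N + 1) := pow_le_pow_of_le_one hh h1 (by omega)
  have hpn : 0 ≤ h ^ (N + 2) := by positivity
  obtain ⟨hE, hR⟩ := stage_error_le (matA N) hL hh (ρ := K₀ * h ^ (N + 2))
    (σ := h ^ (N + 1) * G) (by positivity) (by positivity) hQ
    (fun q => hLip _ (htp q) _ _) hst hsn (by rwa [← hα])
  rw [← hα] at hR
  have hE' : ∀ p, ‖Q p - u (t + node N p * h)‖ ≤ 2 * (1 + K₀ + G) * (e + h ^ (N + 1)) := by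
    intro p
    refine (hE p).trans ?_
    have e1 := mul_le_mul_of_nonneg_left hp2 hK₀
    have e2 := mul_nonneg (add_nonneg hK₀ hG0) he0
    have e3 := pow_nonneg hh (N + 1)
    linarith
  have hR' : ∀ p, ‖Q p - (u (t + node N p * h) - s p)‖ ≤ C₁ * (e + h ^ (N + 2)) := by
    intro p
    refine (hR p).trans ?_
    have e1 : h * (e + K₀ * h ^ (N + 2) + h ^ (N + 1) * G) ≤
        (1 + K₀ + G) * (e + h ^ (N + 2)) := by
      have a1 : h * e ≤ e := mul_le_of_le_one_left he0 h1
      have a2 : h * (K₀ * h ^ (N + 2)) ≤ K₀ * h ^ (N + 2) :=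
        mul_le_of_le_one_left (by positivity) h1
      have a3 : h * (h ^ (N + 1) * G) = G * h ^ (N + 2) := by ring
      have a4 := mul_nonneg (add_nonneg hK₀ hG0) he0
      linarith
    have e2 := mul_le_mul_of_nonneg_left e1 (show 0 ≤ 2 * α * L by positivity)
    have e3 : 0 ≤ K₀ * e := by positivity
    rw [hC₁]
    linarith
  obtain ⟨J, hJ⟩ := hlin t h ht hh h1 hth
  have hB : ∀ p, ‖F (Q p) (t + node N p * h) - F (u (t + node N p * h)) (t + node N p * h) +
      J (s p)‖ ≤ (L * C₁ + C₂) * (e + h ^ (N + 2)) := by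
    intro p
    have h2 : ‖F (u (t + node N p * h) - s p) (t + node N p * h) -
        F (u (t + node N p * h)) (t + node N p * h) + J (s p)‖ ≤ C₂ * h ^ (N + 2) := by
      refine (hJ _ (node_mem_Icc N p) (s p)
        ((hsn p).trans (mul_le_mul_of_nonneg_right hp1 hG0))).trans
        ((mul_le_mul_of_nonneg_left (hsn p) (by positivity)).trans_eq ?_)
      rw [hC₂]
      ring
    have h3 := (hLip _ (htp p) (Q p) (u (t + node N p * h) - s p)).trans
      (mul_le_mul_of_nonneg_left (hR' p) hL)
    have h4 : 0 ≤ C₂ * e := mul_nonneg hC₂0 he0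
    calc _ = ‖(F (Q p) (t + node N p * h) -
            F (u (t + node N p * h) - s p) (t + node N p * h)) +
          (F (u (t + node N p * h) - s p) (t + node N p * h) -
            F (u (t + node N p * h)) (t + node N p * h) + J (s p))‖ := by
          congr 1
          abel
      _ ≤ L * (C₁ * (e + h ^ (N + 2))) + C₂ * h ^ (N + 2) :=
          (norm_add_le _ _).trans (add_le_add h3 h2)
      _ ≤ _ := by linarith
  -- Every `J (s p)` is a multiple of `J (c t)`, with factor proportional to `stageDefect N p`, so
  -- the orthogonality to the weights applies.
  have hJ0 : ∑ p, weight N p • J (s p) = 0 := by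
    have h3 : ∀ p, weight N p • J (s p) =
        (weight N p * stageDefect N p) • h ^ (N + 1) • J (c t) := by
      intro p
      simp only [hs, map_smul, smul_smul]
      congr 1
      ring
    simp only [h3]
    rw [← Finset.sum_smul, sum_weight_mul_stageDefect hN, zero_smul]
  refine ⟨fun p => (hE' p).trans (mul_le_mul_of_nonneg_right ?_ (by positivity)), ?_⟩
  · linarith [mul_nonneg hω0 (add_nonneg (mul_nonneg hL hC₁0) hC₂0)]
  · have h4 := norm_sum_smul_le (weight N) _ hB
    rw [← hω] at h4
    calc _ = ‖(y - u t) + h • ∑ p, weight N p • (F (Q p) (t + node N p * h) -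
            F (u (t + node N p * h)) (t + node N p * h) + J (s p)) -
          (u (t + h) - u t - h • ∑ p, weight N p •
            F (u (t + node N p * h)) (t + node N p * h))‖ := by
          congr 1
          simp only [smul_add, smul_sub, Finset.sum_add_distrib, Finset.sum_sub_distrib, hJ0,
            add_zero]
          abel
      _ ≤ e + h * (ω * ((L * C₁ + C₂) * (e + h ^ (N + 2)))) + K₀ * h ^ (N + 3) := by
          refine (norm_sub_le _ _).trans (add_le_add ((norm_add_le _ _).trans
            (add_le_add le_rfl ?_)) hup)
          rw [norm_smul, Real.norm_eq_abs, abs_of_nonneg hh]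
          exact mul_le_mul_of_nonneg_left h4 hh
      _ ≤ _ := by
          have e2 : 0 ≤ K₀ * h * e := by positivity
          have e3 : 0 ≤ 2 * (1 + K₀ + G) * h * (e + h ^ (N + 2)) := by positivity
          have e4 : (2 * (1 + K₀ + G) + ω * (L * C₁ + C₂) + K₀) * h * (e + h ^ (N + 2)) =
              2 * (1 + K₀ + G) * h * (e + h ^ (N + 2)) +
                h * (ω * ((L * C₁ + C₂) * (e + h ^ (N + 2)))) + K₀ * h * e +
                K₀ * h ^ (N + 3) := by ring
          linarith

end

/-! ### Norm estimates, discrete Gronwall inequality and global error. -/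

section

theorem eLpNorm_restrict_Icc_le {E : Type*} [NormedAddCommGroup E] {a b X : ℝ} (hab : a ≤ b)
    {f : ℝ → E} (hf : ∀ t ∈ Icc a b, ‖f t‖ ≤ X) {p : ℝ} (hp : 1 ≤ p) :
    eLpNorm f (ENNReal.ofReal p) (volume.restrict (Icc a b)) ≤
      ENNReal.ofReal ((b - a) ^ (1 / p) * X) := by
  have h := eLpNorm_le_of_ae_bound (p := ENNReal.ofReal p) (μ := volume.restrict (Icc a b))
    ((ae_restrict_iff' measurableSet_Icc).2 (Filter.Eventually.of_forall hf))
  rwa [Measure.restrict_apply_univ, Real.volume_Icc, ENNReal.toReal_ofReal (by linarith),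
    ENNReal.ofReal_rpow_of_nonneg (sub_nonneg.2 hab) (by positivity),
    ← ENNReal.ofReal_mul (Real.rpow_nonneg (sub_nonneg.2 hab) _), ← one_div] at h

theorem eLpNorm_top_restrict_Icc_le {E : Type*} [NormedAddCommGroup E] {a b X : ℝ}
    {f : ℝ → E} (hf : ∀ t ∈ Icc a b, ‖f t‖ ≤ X) :
    eLpNorm f ⊤ (volume.restrict (Icc a b)) ≤ ENNReal.ofReal X := by
  rw [eLpNorm_exponent_top]
  exact eLpNormEssSup_le_of_ae_bound
    ((ae_restrict_iff' measurableSet_Icc).2 (Filter.Eventually.of_forall hf))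

variable {D N M : ℕ} {t₀ tf : ℝ} {F : (Fin D → ℝ) → ℝ → Fin D → ℝ} {u₀ : Fin D → ℝ}

theorem Grid.pt_succ (g : Grid t₀ tf M) (n : Fin M) :
    g.pt n.succ = g.pt n.castSucc + g.step n := by
  rw [Grid.step]
  ring

theorem exists_isSolution (g : Grid t₀ tf M)
    (h : ∀ (n : Fin M) (y : Fin D → ℝ), ∃ q : Fin (N + 1) → Fin D → ℝ, ∀ p,
      q p - g.step n • ∑ r, matA N p r • F (q r) (g.time n (node N r)) = y) :
    ∃ (U : Fin (M + 1) → Fin D → ℝ) (Q : Fin M → Fin (N + 1) → Fin D → ℝ),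
      IsSolution F u₀ g U Q := by
  choose q hq using h
  set U : Fin (M + 1) → Fin D → ℝ := fun n => Fin.induction (motive := fun _ => Fin D → ℝ) u₀
    (fun n y => y + g.step n • ∑ p, weight N p • F (q n y p) (g.time n (node N p))) n with hU
  exact ⟨U, fun n => q n (U n.castSucc), rfl, fun n p => hq n _ p, fun n => by
    simp only [hU, Fin.induction_succ]⟩

/-- A discrete Gronwall inequality on a grid. -/
theorem Grid.gronwall (g : Grid t₀ tf M) {e : Fin (M + 1) → ℝ} {K m : ℝ} (hK : 0 ≤ K)
    (hm : 0 ≤ m) (he : ∀ n, 0 ≤ e n) (h0 : e 0 = 0)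
    (hstep : ∀ n : Fin M, e n.succ ≤ e n.castSucc + K * g.step n * (e n.castSucc + m))
    (n : Fin (M + 1)) : e n ≤ Real.exp (K * (tf - t₀)) * m := by
  -- The shifted quantity `e n + m` obeys the homogeneous recursion with factor `1 + K * g.step n`,
  -- which is at most an exponential.
  have key : e n + m ≤ Real.exp (K * (g.pt n - t₀)) * m := by
    induction n using Fin.induction with
    | zero => simp [h0, g.first]
    | succ n ih =>
      have hs := (g.step_pos n).le
      have h1 := Real.add_one_le_exp (K * g.step n)
      calc e n.succ + m ≤ (K * g.step n + 1) * (e n.castSucc + m) := by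
            linarith [hstep n]
        _ ≤ Real.exp (K * g.step n) * (Real.exp (K * (g.pt n.castSucc - t₀)) * m) :=
            mul_le_mul h1 ih (add_nonneg (he _) hm) (Real.exp_pos _).le
        _ = _ := by
            rw [← mul_assoc, ← Real.exp_add, g.pt_succ]
            congr 2
            ring
  have h2 : Real.exp (K * (g.pt n - t₀)) ≤ Real.exp (K * (tf - t₀)) :=
    Real.exp_le_exp.2 (mul_le_mul_of_nonneg_left (by linarith [(g.pt_mem_Icc n).2]) hK)
  linarith [mul_le_mul_of_nonneg_right h2 hm]

theorem exists_time_eq (g : Grid t₀ tf M) (ht : t₀ < tf)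
    (U : Fin (M + 1) → Fin D → ℝ) (Q : Fin M → Fin (N + 1) → Fin D → ℝ) {t : ℝ}
    (h : t ∈ Icc t₀ tf) :
    ∃ n, ∃ τ ∈ Icc (0 : ℝ) 1, g.pt n.castSucc + τ * g.step n = t ∧
      uIL F g U Q t = improvedLocalSol F g U Q n τ ∧ uL g Q t = localSol Q n τ := by
  obtain ⟨n, hn⟩ := g.exists_mem_cell ht h
  exact ⟨n, _, g.div_step_mem_Icc (g.cell_subset n hn), g.time_div_step n t,
    g.assemble_of_mem_cell _ hn, g.assemble_of_mem_cell _ hn⟩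

/-- Existence of solutions and pointwise error bounds for the two local solutions. -/
theorem exists_error_bound (hN : 1 ≤ N) (ht : t₀ < tf)
    (hF : ContDiffOn ℝ ((N + 2 : ℕ) : WithTop ℕ∞) (fun z : (Fin D → ℝ) × ℝ => F z.1 z.2)
      (univ ×ˢ Icc t₀ tf)) {L : ℝ} (hL : 0 ≤ L)
    (hLip : ∀ t ∈ Icc t₀ tf, ∀ x y : Fin D → ℝ, ‖F x t - F y t‖ ≤ L * ‖x - y‖)
    {u : ℝ → Fin D → ℝ} (hu₀ : u t₀ = u₀)
    (hu : ∀ t ∈ Icc t₀ tf, HasDerivWithinAt u (F (u t) t) (Icc t₀ tf) t) :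
    ∃ C > 0, ∃ δ > 0, ∀ (M : ℕ) (g : Grid t₀ tf M), g.mesh ≤ δ →
      (∃ (U : Fin (M + 1) → Fin D → ℝ) (Q : Fin M → Fin (N + 1) → Fin D → ℝ),
        IsSolution F u₀ g U Q) ∧
      ∀ (U : Fin (M + 1) → Fin D → ℝ) (Q : Fin M → Fin (N + 1) → Fin D → ℝ),
        IsSolution F u₀ g U Q →
        ∀ t ∈ Icc t₀ tf, ‖uIL F g U Q t - u t‖ ≤ C * g.mesh ^ (N + 2) ∧
          ‖uL g Q t - u t‖ ≤ C * g.mesh ^ (N + 1) := by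
  have huC := contDiffOn_solution ht hF hu
  have hvC : ContDiffOn ℝ ((N + 2 : ℕ) : WithTop ℕ∞) (fun t => F (u t) t) (Icc t₀ tf) :=
    hF.comp ((huC.of_le (by exact_mod_cast Nat.le_succ _)).prodMk contDiffOn_id)
      fun t ht => ⟨mem_univ _, ht⟩
  obtain ⟨K, hK, hstep⟩ := exists_step_bound hN ht hL hF hLip hu
  obtain ⟨K', hK', hdense⟩ := exists_dense_defect_bound (N := N) ht hu
    (huC.of_le (by exact_mod_cast (by omega : N + 1 ≤ N + 2 + 1)))
    (hvC.of_le (by exact_mod_cast Nat.le_succ _))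
  obtain ⟨Λ, hΛ, hΛ1, hΛ2⟩ := exists_sum_abs_phi_le N
  set α := ∑ p, ∑ q, |matA N p q| with hα
  have hα0 : 0 ≤ α := Finset.sum_nonneg fun _ _ => Finset.sum_nonneg fun _ _ => abs_nonneg _
  set c := Real.exp (K * (tf - t₀)) with hc
  have hc0 : 0 ≤ c := (Real.exp_pos _).le
  clear_value α c
  have hαL : 0 ≤ α * L := mul_nonneg hα0 hL
  -- One constant serves both estimates: `c` from the nodes, `Λ * L * K * (c + 1)` and `Λ * K * (c +
  -- 1)` from the stages in the improved and the plain local solution, `K'` from the dense defects,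
  -- and 1 for positivity. The bound on the mesh gives steps at most 1 and the contraction
  -- condition.
  refine ⟨c + (Λ * L * K + Λ * K) * (c + 1) + K' + 1, by positivity,
    min 1 (1 / (2 * (α * L + 1))), by positivity, fun M g hg => ?_⟩
  have hmesh1 : g.mesh ≤ 1 := hg.trans (min_le_left _ _)
  have hh0 : ∀ n, 0 ≤ g.step n := fun n => (g.step_pos n).le
  have hh1 : ∀ n, g.step n ≤ 1 := fun n => (g.step_le_mesh n).trans hmesh1
  have hsmall : ∀ n, g.step n * α * L ≤ 1 / 2 := fun n => by
    have h1 := (g.step_le_mesh n).trans (hg.trans (min_le_right _ _))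
    rw [le_div_iff₀ (by positivity)] at h1
    linarith [hh0 n]
  have hmem : ∀ n : Fin M, g.pt n.castSucc + g.step n ∈ Icc t₀ tf := fun n => by
    rw [← g.pt_succ]
    exact g.pt_mem_Icc _
  refine ⟨exists_isSolution g fun n y => ?_, fun U Q hsol => ?_⟩
  · exact exists_stages (matA N) (f := fun r x => F x (g.time n (node N r))) hL (hh0 n)
      (fun q x y => hLip _ (g.time_mem_Icc n (node_mem_Icc N q)) x y)
      (by rw [← hα]; exact hsmall n) y
  have hloc := fun n : Fin M =>
    hstep (g.pt n.castSucc) (g.step n) (g.pt_mem_Icc n.castSucc) (hh0 n) (hh1 n)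
    (hmem n) (hsmall n) (U n.castSucc) (Q n) (hsol.predictor n)
  have hmesh0 : 0 ≤ g.mesh := by
    obtain ⟨n, -⟩ := g.exists_mem_cell ht (left_mem_Icc.2 ht.le)
    exact (hh0 n).trans (g.step_le_mesh n)
  have hpow : ∀ (n : Fin M) (k : ℕ), g.step n ^ k ≤ g.mesh ^ k := fun n k =>
    pow_le_pow_left₀ (hh0 n) (g.step_le_mesh n) k
  have hnode : ∀ n, ‖U n - u (g.pt n)‖ ≤ c * g.mesh ^ (N + 2) := by
    rw [hc]
    refine g.gronwall hK (by positivity) (fun n => norm_nonneg _) ?_ fun n => ?_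
    · rw [hsol.init, g.first, hu₀, sub_self, norm_zero]
    · rw [g.pt_succ, hsol.update]
      refine (hloc n).2.trans (add_le_add le_rfl (mul_le_mul_of_nonneg_left ?_
        (mul_nonneg hK (hh0 n))))
      exact add_le_add le_rfl (hpow n _)
  intro t htt
  obtain ⟨n, τ, hτ, rfl, hIL, hLoc⟩ := exists_time_eq (F := F) g ht U Q htt
  set h := g.step n with hh
  obtain ⟨hd1, hd2⟩ := hdense (g.pt n.castSucc) h (g.pt_mem_Icc _) (hh0 n) (hmem n) τ hτ
  have hstage := (hloc n).1
  set e := ‖U n.castSucc - u (g.pt n.castSucc)‖ with he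
  have he0 : 0 ≤ e := norm_nonneg _
  have hen : e ≤ c * g.mesh ^ (N + 2) := hnode n.castSucc
  have hm2 : g.mesh ^ (N + 2) ≤ g.mesh ^ (N + 1) :=
    pow_le_pow_of_le_one hmesh0 hmesh1 (Nat.le_succ _)
  constructor
  · rw [hIL, improvedLocalSol_eq]
    have h1 := norm_sum_smul_le (fun p => ∫ ξ in (0 : ℝ)..τ, (phi N p).eval ξ)
      (fun p => F (Q n p) (g.time n (node N p)) -
        F (u (g.pt n.castSucc + node N p * h)) (g.pt n.castSucc + node N p * h))
      (X := L * (K * (e + h ^ (N + 1)))) fun p =>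
        (hLip _ (g.time_mem_Icc n (node_mem_Icc N p)) _ _).trans
          (mul_le_mul_of_nonneg_left (hstage p) hL)
    -- The factor `h` of the integral raises the stage error to order `N + 2`; in the plain local
    -- solution it is absent.
    have h2 : h * (e + h ^ (N + 1)) ≤ (c + 1) * g.mesh ^ (N + 2) := by
      have e1 : h * e ≤ e := mul_le_of_le_one_left he0 (hh1 n)
      have e2 : h * h ^ (N + 1) = h ^ (N + 2) := by ring
      linarith [hpow n (N + 2)]
    calc _ = ‖(U n.castSucc - u (g.pt n.castSucc)) +
            h • ∑ p, (∫ ξ in (0 : ℝ)..τ, (phi N p).eval ξ) • (F (Q n p) (g.time n (node N p)) -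
              F (u (g.pt n.castSucc + node N p * h)) (g.pt n.castSucc + node N p * h)) -
            (u (g.pt n.castSucc + τ * h) - u (g.pt n.castSucc) -
              h • ∑ p, (∫ ξ in (0 : ℝ)..τ, (phi N p).eval ξ) •
                F (u (g.pt n.castSucc + node N p * h)) (g.pt n.castSucc + node N p * h))‖ := by
          congr 1
          simp only [smul_sub, Finset.sum_sub_distrib]
          abel
      _ ≤ e + h * (Λ * (L * (K * (e + h ^ (N + 1))))) + K' * h ^ (N + 2) := by
          refine (norm_sub_le _ _).trans (add_le_add ((norm_add_le _ _).trans
            (add_le_add le_rfl ?_)) hd1)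
          rw [norm_smul, Real.norm_eq_abs, abs_of_nonneg (hh0 n)]
          refine mul_le_mul_of_nonneg_left (h1.trans (mul_le_mul_of_nonneg_right (hΛ2 τ hτ) ?_))
            (hh0 n)
          have := hh0 n
          positivity
      _ = e + Λ * L * K * (h * (e + h ^ (N + 1))) + K' * h ^ (N + 2) := by ring
      _ ≤ c * g.mesh ^ (N + 2) + Λ * L * K * ((c + 1) * g.mesh ^ (N + 2)) +
            K' * g.mesh ^ (N + 2) :=
          add_le_add (add_le_add hen (mul_le_mul_of_nonneg_left h2 (by positivity)))
            (mul_le_mul_of_nonneg_left (hpow n _) hK')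
      _ ≤ _ := by
          have e3 : 0 ≤ (Λ * K * (c + 1) + 1) * g.mesh ^ (N + 2) := by positivity
          linarith
  · rw [hLoc, localSol]
    have h1 := norm_sum_smul_le (fun p => (phi N p).eval τ)
      (fun p => Q n p - u (g.pt n.castSucc + node N p * h)) hstage
    have h2 : e + h ^ (N + 1) ≤ (c + 1) * g.mesh ^ (N + 1) := by
      linarith [hpow n (N + 1), mul_le_mul_of_nonneg_left hm2 hc0]
    calc _ = ‖∑ p, (phi N p).eval τ • (Q n p - u (g.pt n.castSucc + node N p * h)) +
            (∑ p, (phi N p).eval τ • u (g.pt n.castSucc + node N p * h) -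
              u (g.pt n.castSucc + τ * h))‖ := by
          congr 1
          simp only [smul_sub, Finset.sum_sub_distrib]
          abel
      _ ≤ Λ * (K * (e + h ^ (N + 1))) + K' * h ^ (N + 1) := by
          refine (norm_add_le _ _).trans (add_le_add (h1.trans
            (mul_le_mul_of_nonneg_right (hΛ1 τ hτ) ?_)) hd2)
          have := hh0 n
          positivity
      _ ≤ Λ * (K * ((c + 1) * g.mesh ^ (N + 1))) + K' * g.mesh ^ (N + 1) :=
          add_le_add (mul_le_mul_of_nonneg_left (mul_le_mul_of_nonneg_left h2 hK) hΛ)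
            (mul_le_mul_of_nonneg_left (hpow n _) hK')
      _ ≤ _ := by
          have e3 : 0 ≤ (c + Λ * L * K * (c + 1) + 1) * g.mesh ^ (N + 1) := by positivity
          linarith

end

end ADERDG

end

theorem mainTheorem2 (D N : ℕ) (t₀ tf : ℝ) (ht : t₀ < tf)
    (F : (Fin D → ℝ) → ℝ → Fin D → ℝ) (u₀ : Fin D → ℝ) :
    -- matching of the nodal values and continuity, on every grid
    (∀ (M : ℕ) (g : ADERDG.Grid t₀ tf M) (U : Fin (M + 1) → Fin D → ℝ)
        (Q : Fin M → Fin (N + 1) → Fin D → ℝ), ADERDG.IsSolution F u₀ g U Q →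
      (∀ n τ, ADERDG.improvedLocalSol F g U Q n τ = U n.castSucc + g.step n •
          ∑ p, (∫ ξ in (0 : ℝ)..τ, (ADERDG.phi N p).eval ξ) •
            F (ADERDG.localSol Q n (ADERDG.node N p)) (g.time n (ADERDG.node N p))) ∧
      (∀ n, ADERDG.improvedLocalSol F g U Q n 0 = U n.castSucc) ∧
      (∀ n, ADERDG.improvedLocalSol F g U Q n 1 = U n.succ) ∧
      (∀ n, ADERDG.uIL F g U Q (g.pt n) = U n) ∧
      ContinuousOn (ADERDG.uIL F g U Q) (Icc t₀ tf)) ∧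
    -- the error estimates
    (1 ≤ N →
      ContDiffOn ℝ ((N + 2 : ℕ) : WithTop ℕ∞) (fun z : (Fin D → ℝ) × ℝ => F z.1 z.2)
        (univ ×ˢ Icc t₀ tf) →
      ∀ L : ℝ, (∀ t ∈ Icc t₀ tf, ∀ x y : Fin D → ℝ, ‖F x t - F y t‖ ≤ L * ‖x - y‖) →
      ∀ u : ℝ → Fin D → ℝ, u t₀ = u₀ →
        (∀ t ∈ Icc t₀ tf, HasDerivWithinAt u (F (u t) t) (Icc t₀ tf) t) →
      ∃ C > 0, ∃ δ > 0, ∀ (M : ℕ) (g : ADERDG.Grid t₀ tf M), g.mesh ≤ δ →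
        (∃ (U : Fin (M + 1) → Fin D → ℝ) (Q : Fin M → Fin (N + 1) → Fin D → ℝ),
          ADERDG.IsSolution F u₀ g U Q) ∧
        ∀ (U : Fin (M + 1) → Fin D → ℝ) (Q : Fin M → Fin (N + 1) → Fin D → ℝ),
          ADERDG.IsSolution F u₀ g U Q →
          (∀ t ∈ Icc t₀ tf, ‖ADERDG.uIL F g U Q t - u t‖ ≤ C * g.mesh ^ (N + 2)) ∧
          eLpNorm (fun t => ADERDG.uIL F g U Q t - u t) ⊤ (volume.restrict (Icc t₀ tf))
            ≤ ENNReal.ofReal (C * g.mesh ^ (N + 2)) ∧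
          (∀ p : ℝ, 1 ≤ p →
            eLpNorm (fun t => ADERDG.uIL F g U Q t - u t) (ENNReal.ofReal p)
                (volume.restrict (Icc t₀ tf))
              ≤ ENNReal.ofReal ((tf - t₀) ^ (1 / p) * C * g.mesh ^ (N + 2))) ∧
          eLpNorm (fun t => ADERDG.uL g Q t - u t) ⊤ (volume.restrict (Icc t₀ tf))
            ≤ ENNReal.ofReal (C * g.mesh ^ (N + 1)) ∧
          (∀ p : ℝ, 1 ≤ p →
            eLpNorm (fun t => ADERDG.uL g Q t - u t) (ENNReal.ofReal p)
                (volume.restrict (Icc t₀ tf))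
              ≤ ENNReal.ofReal ((tf - t₀) ^ (1 / p) * C * g.mesh ^ (N + 1)))) := by
  refine ⟨fun M g U Q h => ⟨fun n τ => ?_, fun n => ADERDG.improvedLocalSol_zero F g U Q n,
    h.improvedLocalSol_one, h.uIL_pt ht, h.continuousOn_uIL ht⟩, ?_⟩
  · rw [ADERDG.improvedLocalSol_eq]
    simp only [ADERDG.localSol_node]
  · intro hN hF L hLip u hu₀ hu
    -- The given Lipschitz constant may be negative when the condition is vacuous (`D = 0`), so
    -- `|L|` takes its place.
    obtain ⟨C, hC, δ, hδ, H⟩ := ADERDG.exists_error_bound hN ht hF (abs_nonneg L)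
      (fun t ht x y => (hLip t ht x y).trans
        (mul_le_mul_of_nonneg_right (le_abs_self L) (norm_nonneg _))) hu₀ hu
    refine ⟨C, hC, δ, hδ, fun M g hg => ⟨(H M g hg).1, fun U Q h => ?_⟩⟩
    have hIL := fun t htt => ((H M g hg).2 U Q h t htt).1
    have hL := fun t htt => ((H M g hg).2 U Q h t htt).2
    refine ⟨hIL, ADERDG.eLpNorm_top_restrict_Icc_le hIL, fun p hp => ?_,
      ADERDG.eLpNorm_top_restrict_Icc_le hL, fun p hp => ?_⟩
    · rw [mul_assoc]
      exact ADERDG.eLpNorm_restrict_Icc_le ht.le hIL hp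
    · rw [mul_assoc]
      exact ADERDG.eLpNorm_restrict_Icc_le ht.le hL hp
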